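/- Let $S(0,\pi)=\{\zeta\in\mathbb C: 0<\operatorname{Im}\zeta<\pi\}$. A *scattering function* is a function $S_2:\overline{S(0,\pi)}\to\mathbb C$ that is analytic on $S(0,\pi)$, bounded and continuous on the closed strip $\overline{S(0,\pi)}$, and satisfies $$\overline{S_2(\theta)}=S_2(\theta)^{-1}=S_2(-\theta)=S_2(\theta+i\pi),\qquad \theta\in\mathbb R$$ (in particular $S_2(\theta)\neq0$ for $\theta\in\mathbb R$). Let $\mathcal S$ be the set of all scattering functions. Let $\mathcal Z$ be the family of all finite (possibly empty) or infinite sequences $\{\beta_k\}\subset\mathbb C$ such that 1. $0<\operatorname{Im}\beta_k\le\frac{\pi}{2}$ for all $k$; 2. every $w\in\mathbb C$ appears only finitely often in $\{\beta_k\}$, and, if $\operatorname{Im}w<\frac\pi2$, then $w$ and $-\overline{w}$ appear the same number of times (no symmetry is required on the line $\operatorname{Im}w=\frac\pi2$, where $\sinh(-\overline w)=\sinh w$); 3. $\{\beta_k\}$ has no finite limit point; 4. $\sum_k\left|\operatorname{Im}\frac{1}{\sinh\beta_k}\right|<\infty$. Then $$\mathcal S=\Big\{\zeta\mapsto\varepsilon\cdot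 e^{ia\sinh\zeta}\cdot\prod_k\frac{\sinh\beta_k-\sinh\zeta}{\sinh\beta_k+\sinh\zeta}\;:\;\varepsilon=\pm1,\ a\ge0,\ \{\beta_k\}\in\mathcal Z\Big\},$$ as functions on $\overline{S(0,\pi)}$. Here the product is formed by taking the factors of $\beta_k$ and of its partner $-\overline{\beta_k}$ together as one factor whenever $\operatorname{Re}\beta_k\ne0$ and $\operatorname{Im}\beta_k<\frac\pi2$; the other factors stand alone. For every $\{\beta_k\}\in\mathcal Z$ the product so grouped, with factors $f_k(\zeta)$, converges absolutely and uniformly on compact subsets $K$ of the closed strip $\overline{S(0,\pi)}$ (hence in particular of $S(0,\pi)$): $\sum_k|f_k(\zeta)-1|$ converges uniformly on $K$, and the finite partial products converge, independently of the order, uniformly on $K$ to $\prod_k f_k(\zeta)$. -/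

import Mathlib

noncomputable section

/-- The open strip `S(0,π) = {ζ : 0 < Im ζ < π}`. -/
def openStrip : Set ℂ := {ζ | 0 < ζ.im ∧ ζ.im < Real.pi}

/-- The closed strip `{ζ : 0 ≤ Im ζ ≤ π}`, the closure of `S(0,π)`. -/
def closedStrip : Set ℂ := {ζ | 0 ≤ ζ.im ∧ ζ.im ≤ Real.pi}

/-- `S` is a scattering function: analytic on the strip `S(0,π)`, bounded and continuous on its
closure, and `conj (S θ) = (S θ)⁻¹ = S (-θ) = S (θ + iπ)` for real `θ`. Only the values of `S` on
the closed strip matter. The field `ne_zero` says that the inverse `(S θ)⁻¹` exists; without it the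
convention `0⁻¹ = 0` would admit the zero function. -/
structure IsScatteringFunction (S : ℂ → ℂ) : Prop where
  analytic : AnalyticOnNhd ℂ S openStrip
  continuousOn : ContinuousOn S closedStrip
  bounded : ∃ C : ℝ, ∀ ζ ∈ closedStrip, ‖S ζ‖ ≤ C
  ne_zero : ∀ θ : ℝ, S θ ≠ 0
  conj_eq_inv : ∀ θ : ℝ, (starRingEnd ℂ) (S θ) = (S θ)⁻¹
  inv_eq_neg : ∀ θ : ℝ, (S θ)⁻¹ = S (-θ)
  neg_eq_shift : ∀ θ : ℝ, S (-θ) = S (θ + Complex.I * Real.pi)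

/-- The index set `{k : k < N}` of a finite (`N < ⊤`, possibly `N = 0`) or infinite (`N = ⊤`)
sequence. -/
abbrev SeqIndex (N : ℕ∞) : Type := {k : ℕ // (k : ℕ∞) < N}

/-- The admissible zero sequences.

* `im_pos`, `im_le`: `0 < Im β_k ≤ π/2`;
* `mult_finite`: every number appears only finitely often in the sequence;
* `mult_symm`: `w` and `-conj w` appear the same number of times, for `Im w < π/2`. (On the line
  `Im w = π/2` one has `sinh (-conj w) = sinh w`, so both points stand for the same factor of the
  product and no condition is imposed.)
* `no_limit_point`: no finite limit point: every `z : ℂ` has a neighbourhood containing `β_k`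
  for only finitely many `k`;
* `summable`: the series `∑ Im (1 / sinh β_k)` converges (all its terms are negative, so this is
  absolute convergence). -/
structure IsZeroSequence {N : ℕ∞} (β : SeqIndex N → ℂ) : Prop where
  im_pos : ∀ k, 0 < (β k).im
  im_le : ∀ k, (β k).im ≤ Real.pi / 2
  mult_finite : ∀ w : ℂ, {k | β k = w}.Finite
  mult_symm : ∀ w : ℂ, w.im < Real.pi / 2 →
    {k | β k = w}.ncard = {k | β k = -(starRingEnd ℂ) w}.ncard
  no_limit_point : ∀ z : ℂ, ¬ MapClusterPt z Filter.cofinite β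
  summable : Summable fun k => (1 / Complex.sinh (β k)).im

/-- The elementary factor `(sinh β - sinh ζ) / (sinh β + sinh ζ)`. -/
def sinhFactor (β ζ : ℂ) : ℂ :=
  (Complex.sinh β - Complex.sinh ζ) / (Complex.sinh β + Complex.sinh ζ)

open Classical in
/-- The contribution of a member `β` of a zero sequence to the product, where the factors of `β`
and `-conj β` are taken together. If `β` is its own partner (`Re β = 0`) or has no partner
(`Im β = π/2`), it contributes its own factor. Otherwise `β` and `-conj β` occur equally often; the
member with positive real part contributes the factors of both, the one with negative real part
contributes `1`. -/
def pairedFactor (β ζ : ℂ) : ℂ :=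
  if β.re = 0 ∨ β.im = Real.pi / 2 then sinhFactor β ζ
  else if 0 < β.re then sinhFactor β ζ * sinhFactor (-(starRingEnd ℂ) β) ζ
  else 1

end

/-! The substitution `p = -i sinh ζ` (`stripMap`) maps the closed strip onto the closed right
half-plane, and on the strip it identifies exactly `ζ` and `iπ - ζ`. The boundary relations give
`S(iπ - ζ) = S(ζ)` and `S(-conj ζ) = conj (S ζ)` on both edges, and Phragmén–Lindelöf carries them
inside. Hence `S = F ∘ stripMap`, where `F` is inner on the half-plane, continuous and unimodular on
the imaginary axis, and satisfies `F(conj p) = conj (F p)` (`exists_isSymmetricInner`).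

It remains to factor such an `F` (`exists_factorization`). Unimodularity on the axis prevents zeros
from accumulating at finite points. Dividing out finitely many zeros by the Schwarz lemma bounds
`|F|` by partial Blaschke products, which yields the Blaschke condition `∑ Re q / |q|² < ∞`. Since
`Re q / |q|² = -Im (1 / sinh β)` for `q = -i sinh β`, this is condition 4. The quotient of `F` by
its Blaschke product is zero-free, extends to an entire function by reflection in the axis, and its
logarithm has a real part whose sign is opposite to that of `Re p`. Such a logarithm is affine, so
the quotient is `±exp(-a p)` with `a ≥ 0` (`exists_eq_exp_of_nonvanishing`).

Conversely, products of this form are bounded by 1, unimodular on the axis and symmetric under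
conjugation. Since `stripMap` sends both `-θ` and `θ + iπ` to `conj (stripMap θ)`, the boundary
relations follow (`isScatteringFunction_of_eq`). -/

section

open Complex Filter Topology Set
open scoped ComplexConjugate

/-! ### Symmetric Blaschke factors on the right half-plane. -/

/-- The open right half-plane. -/
def rightHalfPlane : Set ℂ := {p | 0 < p.re}

/-- The closed right half-plane. -/
def closedRightHalfPlane : Set ℂ := {p | 0 ≤ p.re}

lemma rightHalfPlane_subset : rightHalfPlane ⊆ closedRightHalfPlane :=
  fun p (hp : 0 < p.re) => (le_of_lt hp : 0 ≤ p.re)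

lemma isOpen_rightHalfPlane : IsOpen rightHalfPlane :=
  isOpen_lt continuous_const Complex.continuous_re

lemma isClosed_closedRightHalfPlane : IsClosed closedRightHalfPlane :=
  isClosed_le continuous_const Complex.continuous_re

/-- The elementary factor `(q - p) / (q + p)`. -/
noncomputable def bFactor (q p : ℂ) : ℂ := (q - p) / (q + p)

open Classical in
/-- The contribution of `q` to the symmetric Blaschke product: real points contribute their own
factor, points in the lower half-plane contribute the factors of `q` and `conj q`, and points in
the upper half-plane contribute `1`. -/
noncomputable def bPair (q p : ℂ) : ℂ :=
  if q.im = 0 then bFactor q p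
  else if q.im < 0 then bFactor q p * bFactor (conj q) p
  else 1

lemma add_ne_zero_of_mem {q p : ℂ} (hq : 0 < q.re) (hp : 0 ≤ p.re) : q + p ≠ 0 := by
  intro h
  have := congrArg Complex.re h
  simp at this
  linarith

lemma bFactor_conj (q p : ℂ) : bFactor (conj q) (conj p) = conj (bFactor q p) := by
  simp [bFactor]

lemma bFactor_neg (q p : ℂ) : bFactor q (-p) = (bFactor q p)⁻¹ := by
  simp [bFactor, sub_eq_add_neg]

lemma bPair_conj (q p : ℂ) : bPair q (conj p) = conj (bPair q p) := by
  unfold bPair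
  split_ifs with h1 h2
  · rw [← bFactor_conj, Complex.conj_eq_iff_im.2 h1]
  · rw [map_mul, ← bFactor_conj, ← bFactor_conj, Complex.conj_conj, mul_comm]
  · simp

lemma bPair_neg (q p : ℂ) : bPair q (-p) = (bPair q p)⁻¹ := by
  unfold bPair
  split_ifs with h1 h2
  · rw [bFactor_neg]
  · rw [bFactor_neg, bFactor_neg, mul_inv]
  · simp

lemma differentiableAt_bFactor {q p : ℂ} (hq : 0 < q.re) (hp : 0 ≤ p.re) :
    DifferentiableAt ℂ (bFactor q) p := by
  unfold bFactor
  exact DifferentiableAt.div (by fun_prop) (by fun_prop) (add_ne_zero_of_mem hq hp)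

lemma differentiableAt_bPair {q p : ℂ} (hq : 0 < q.re) (hp : 0 ≤ p.re) :
    DifferentiableAt ℂ (bPair q) p := by
  have h1 := differentiableAt_bFactor hq hp
  have h2 : DifferentiableAt ℂ (bFactor (conj q)) p :=
    differentiableAt_bFactor (by simpa using hq) hp
  unfold bPair
  split_ifs
  · exact h1
  · exact h1.mul h2
  · fun_prop

lemma norm_bFactor_mul_conj {q p : ℂ} :
    ‖q - p‖ ^ 2 = ‖conj q + p‖ ^ 2 - 4 * q.re * p.re := by
  rw [← Complex.normSq_eq_norm_sq, ← Complex.normSq_eq_norm_sq, Complex.normSq_apply,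
    Complex.normSq_apply]
  simp
  ring

lemma norm_sub_le_norm_conj_add {q p : ℂ} (hq : 0 < q.re) (hp : 0 ≤ p.re) :
    ‖q - p‖ ≤ ‖conj q + p‖ := by
  have := norm_bFactor_mul_conj (q := q) (p := p)
  have h2 : 0 ≤ 4 * q.re * p.re := by positivity
  exact (sq_le_sq₀ (norm_nonneg _) (norm_nonneg _)).1 (by linarith)

/-- For non-real `q` a single factor need not be bounded by 1: `|q - p|` is controlled by `|conj q +
p|`, not by `|q + p|`. In the pair each numerator is compared with the denominator of the other
factor. -/
lemma norm_bPair_le_one {q p : ℂ} (hq : 0 < q.re) (hp : 0 ≤ p.re) : ‖bPair q p‖ ≤ 1 := by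
  have h0 := add_ne_zero_of_mem hq hp
  have h0' : conj q + p ≠ 0 := add_ne_zero_of_mem (by simpa using hq) hp
  have h1 := norm_sub_le_norm_conj_add hq hp
  have h2 : ‖conj q - p‖ ≤ ‖q + p‖ := by
    simpa using norm_sub_le_norm_conj_add (q := conj q) (by simpa using hq) hp
  unfold bPair bFactor
  split_ifs with hi hi'
  · rw [norm_div]
    rw [Complex.conj_eq_iff_im.2 hi] at h1
    exact div_le_one_of_le₀ h1 (norm_nonneg _)
  · rw [norm_mul, norm_div, norm_div, div_mul_div_comm, mul_comm ‖q + p‖]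
    exact div_le_one_of_le₀ (by gcongr) (by positivity)
  · simp

/-- On the imaginary axis `conj p = -p`, so conjugating the factor inverts it. -/
lemma norm_bPair_eq_one {q p : ℂ} (hq : 0 < q.re) (hp : p.re = 0) : ‖bPair q p‖ = 1 := by
  have hp1 : conj p = -p := by
    apply Complex.ext <;> simp [hp]
  have h := bPair_conj q p
  rw [hp1, bPair_neg] at h
  have hne : bPair q p ≠ 0 := by
    intro h0
    have key : ∀ r : ℂ, 0 < r.re → bFactor r p ≠ 0 := by
      intro r hr
      apply div_ne_zero _ (add_ne_zero_of_mem hr hp.ge)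
      intro h
      have := congrArg Complex.re h
      simp [hp] at this
      linarith
    have hq' : 0 < (conj q).re := by simpa using hq
    unfold bPair at h0
    split_ifs at h0
    · exact key _ hq h0
    · exact mul_ne_zero (key _ hq) (key _ hq') h0
    · exact one_ne_zero h0
  have h2 : bPair q p * conj (bPair q p) = 1 := by rw [← h, mul_inv_cancel₀ hne]
  rw [Complex.mul_conj, Complex.normSq_eq_norm_sq] at h2
  have h3 : ‖bPair q p‖ ^ 2 = 1 := by exact_mod_cast h2
  nlinarith [norm_nonneg (bPair q p)]

/-- Pairing makes the terms summable under the Blaschke condition: the difference from 1 has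
numerator `-4 (Re q) p`, whereas a single factor would only give `O(1/|q|)`. Both denominators are
at least `|q|/2` in norm, whence the constant 16; for real `q` it leaves slack. -/
lemma norm_bPair_sub_one_le {q p : ℂ} {R : ℝ} (hq : 0 < q.re) (hp : 0 ≤ p.re) (hpR : ‖p‖ ≤ R)
    (hqR : 2 * R < ‖q‖) : ‖bPair q p - 1‖ ≤ 16 * R * (q.re / ‖q‖ ^ 2) := by
  have h0 := add_ne_zero_of_mem hq hp
  have h0' : conj q + p ≠ 0 := add_ne_zero_of_mem (by simpa using hq) hp
  have hR : 0 ≤ R := (norm_nonneg p).trans hpR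
  have hqpos : 0 < ‖q‖ := by linarith
  have e1 : ‖q‖ / 2 ≤ ‖q + p‖ := by
    have := norm_sub_le (q + p) p
    simp at this
    linarith
  have e2 : ‖q‖ / 2 ≤ ‖conj q + p‖ := by
    have := norm_sub_le (conj q + p) p
    simp at this
    linarith
  unfold bPair bFactor
  split_ifs with hi hi'
  · have hqr : q.re = ‖q‖ := by
      have : q = (q.re : ℂ) := by apply Complex.ext <;> simp [hi]
      rw [this, Complex.norm_real, Real.norm_of_nonneg] <;> simp [hq.le]
    have : (q - p) / (q + p) - 1 = -(2 * p) / (q + p) := by field_simp; ring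
    rw [this, norm_div, norm_neg, norm_mul, hqr]
    simp only [Complex.norm_ofNat]
    rw [div_le_iff₀ (by positivity)]
    calc 2 * ‖p‖ ≤ 2 * R := by linarith
      _ ≤ 8 * R := by linarith
      _ = 16 * R * (‖q‖ / ‖q‖ ^ 2) * (‖q‖ / 2) := by field_simp; ring
      _ ≤ _ := by gcongr
  · have : (q - p) / (q + p) * ((conj q - p) / (conj q + p)) - 1
        = -(4 * q.re * p) / ((q + p) * (conj q + p)) := by
      have hc : (q.re : ℂ) = (q + conj q) / 2 := by
        rw [Complex.add_conj]; push_cast; ring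
      rw [hc]
      field_simp
      ring
    rw [this, norm_div, norm_neg, norm_mul, norm_mul, norm_mul, Complex.norm_real,
      Real.norm_of_nonneg hq.le]
    simp only [Complex.norm_ofNat]
    rw [div_le_iff₀ (by positivity)]
    calc 4 * q.re * ‖p‖ ≤ 4 * q.re * R := by gcongr
      _ = 16 * R * (q.re / ‖q‖ ^ 2) * (‖q‖ / 2 * (‖q‖ / 2)) := by field_simp; ring
      _ ≤ _ := by gcongr
  · simp; positivity

/-! ### Convergence and boundary values of Blaschke products. -/

/-- Sequences in the right half-plane that satisfy the Blaschke condition and have no finite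
accumulation point. -/
structure IsBlaschkeSeq {ι : Type*} (q : ι → ℂ) : Prop where
  re_pos : ∀ k, 0 < (q k).re
  finite : ∀ R : ℝ, {k | ‖q k‖ ≤ R}.Finite
  summable : Summable fun k => (q k).re / ‖q k‖ ^ 2

/-- The Blaschke product. -/
noncomputable def bProd {ι : Type*} (q : ι → ℂ) (p : ℂ) : ℂ := ∏' k, bPair (q k) p

lemma continuousOn_of_forall_isCompact_subset {f : ℂ → ℂ} {s : Set ℂ} (hs : IsClosed s)
    (h : ∀ K ⊆ s, IsCompact K → ContinuousOn f K) : ContinuousOn f s := by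
  intro x hx
  have hc : IsCompact (s ∩ Metric.closedBall x 1) :=
    (isCompact_closedBall x 1).inter_left hs
  have := h _ inter_subset_left hc x ⟨hx, by simp⟩
  exact this.mono_of_mem_nhdsWithin
    (inter_mem self_mem_nhdsWithin (mem_nhdsWithin_of_mem_nhds (Metric.closedBall_mem_nhds x one_pos)))

namespace IsBlaschkeSeq

variable {ι : Type*} {q : ι → ℂ} (hq : IsBlaschkeSeq q)
include hq

lemma subtype (s : Set ι) : IsBlaschkeSeq (fun k : s => q k) where
  re_pos k := hq.re_pos k
  finite R := (hq.finite R).preimage Subtype.val_injective.injOn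
  summable := hq.summable.subtype s

lemma eventually_norm_le {K : Set ℂ} (hK : IsCompact K) (hKs : K ⊆ closedRightHalfPlane) :
    ∃ R : ℝ, ∀ᶠ k in cofinite, ∀ p ∈ K,
      ‖bPair (q k) p - 1‖ ≤ 16 * R * ((q k).re / ‖q k‖ ^ 2) := by
  obtain ⟨R, hR⟩ := hK.isBounded.exists_norm_le
  refine ⟨R, ?_⟩
  filter_upwards [(hq.finite (2 * R)).compl_mem_cofinite] with k hk p hp
  exact norm_bPair_sub_one_le (hq.re_pos k) (hKs hp) (hR p hp) (not_le.1 hk)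

lemma hasProdUniformlyOn {K : Set ℂ} (hK : IsCompact K) (hKs : K ⊆ closedRightHalfPlane) :
    HasProdUniformlyOn (fun k p => bPair (q k) p) (bProd q) K := by
  obtain ⟨R, hR⟩ := hq.eventually_norm_le hK hKs
  have := (hq.summable.mul_left (16 * R)).hasProdUniformlyOn_one_add
    (f := fun k p => bPair (q k) p - 1) hK hR (fun k p hp =>
      ((differentiableAt_bPair (hq.re_pos k) (hKs hp)).sub_const 1).continuousAt.continuousWithinAt)
  simp only [add_sub_cancel] at this
  exact this

lemma summableUniformlyOn {K : Set ℂ} (hK : IsCompact K) (hKs : K ⊆ closedRightHalfPlane) :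
    SummableUniformlyOn (fun k p => ‖bPair (q k) p - 1‖) K := by
  obtain ⟨R, hR⟩ := hq.eventually_norm_le hK hKs
  refine HasSumUniformlyOn.summableUniformlyOn (g := fun p => ∑' k, ‖bPair (q k) p - 1‖) ?_
  rw [hasSumUniformlyOn_iff_tendstoUniformlyOn]
  exact tendstoUniformlyOn_tsum_of_cofinite_eventually (hq.summable.mul_left (16 * R))
    (by simpa using hR)

lemma summable_norm {p : ℂ} (hp : p ∈ closedRightHalfPlane) :
    Summable fun k => ‖bPair (q k) p - 1‖ :=
  (hq.summableUniformlyOn isCompact_singleton (by simpa using hp)).summable (mem_singleton p)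

lemma hasProd {p : ℂ} (hp : p ∈ closedRightHalfPlane) :
    HasProd (fun k => bPair (q k) p) (bProd q p) :=
  (hq.hasProdUniformlyOn isCompact_singleton (by simpa using hp)).hasProd (mem_singleton p)

lemma continuousOn : ContinuousOn (bProd q) closedRightHalfPlane := by
  refine continuousOn_of_forall_isCompact_subset isClosed_closedRightHalfPlane fun K hKs hK => ?_
  have := hasProdUniformlyOn_iff_tendstoUniformlyOn.1 (hq.hasProdUniformlyOn hK hKs)
  refine this.continuousOn (Frequently.of_forall fun t => ?_)
  exact continuousOn_finsetProd _ fun k _ p hp =>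
    (differentiableAt_bPair (hq.re_pos k) (hKs hp)).continuousAt.continuousWithinAt

lemma differentiableOn : DifferentiableOn ℂ (bProd q) rightHalfPlane := by
  have h1 : HasProdLocallyUniformlyOn (fun k p => bPair (q k) p) (bProd q) rightHalfPlane :=
    hasProdLocallyUniformlyOn_of_forall_compact isOpen_rightHalfPlane fun K hKs hK =>
      hq.hasProdUniformlyOn hK (hKs.trans rightHalfPlane_subset)
  have h2 := hasProdLocallyUniformlyOn_iff_tendstoLocallyUniformlyOn.1 h1
  refine h2.differentiableOn (Eventually.of_forall fun t => ?_) isOpen_rightHalfPlane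
  exact DifferentiableOn.fun_finsetProd fun k _ p hp =>
    (differentiableAt_bPair (hq.re_pos k) (le_of_lt hp)).differentiableWithinAt

lemma norm_le_one {p : ℂ} (hp : p ∈ closedRightHalfPlane) : ‖bProd q p‖ ≤ 1 := by
  refine le_of_tendsto (hq.hasProd hp).norm (Eventually.of_forall fun t => ?_)
  exact Finset.prod_le_one (fun _ _ => norm_nonneg _)
    fun k _ => norm_bPair_le_one (hq.re_pos k) hp

lemma norm_eq_one {p : ℂ} (hp : p.re = 0) : ‖bProd q p‖ = 1 := by
  have h := (hq.hasProd (p := p) hp.ge).norm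
  simp only [norm_bPair_eq_one (hq.re_pos _) hp] at h
  exact h.unique hasProd_one

lemma apply_conj {p : ℂ} (hp : p ∈ closedRightHalfPlane) :
    bProd q (conj p) = conj (bProd q p) := by
  have hp' : conj p ∈ closedRightHalfPlane := by
    simpa [closedRightHalfPlane] using hp
  have h1 := hq.hasProd hp'
  have h2 := (hq.hasProd hp).map (starRingEnd ℂ) Complex.continuous_conj
  refine h1.unique (h2.congr_fun fun k => ?_)
  simp [bPair_conj]

lemma ne_zero {p : ℂ} (hp : p ∈ closedRightHalfPlane) (h : ∀ k, bPair (q k) p ≠ 0) :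
    bProd q p ≠ 0 := by
  have := tprod_one_add_ne_zero_of_summable (f := fun k => bPair (q k) p - 1)
    (by simpa using h) (hq.summable_norm hp)
  simpa [bProd] using this

lemma eq_prod_mul (T : Finset ι) {p : ℂ} (hp : p ∈ closedRightHalfPlane) :
    bProd q p = (∏ k ∈ T, bPair (q k) p) * bProd (fun k : {k // k ∉ T} => q k) p := by
  have h1 := (hq.subtype {k | k ∉ T}).hasProd hp
  have h2 := (T.hasProd (fun k => bPair (q k) p)).mul_compl h1
  exact (hq.hasProd hp).unique h2

end IsBlaschkeSeq

/-! ### Zero-free inner functions: reflection, logarithm and linearity. -/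

/-- A continuous function that is holomorphic off the imaginary axis is entire. -/
theorem differentiable_of_continuous_of_differentiableAt_off_axis {f : ℂ → ℂ} (hc : Continuous f)
    (hd : ∀ p : ℂ, p.re ≠ 0 → DifferentiableAt ℂ f p) : Differentiable ℂ f := by
  rw [← differentiableOn_univ, ← isConservativeOn_and_continuousOn_iff_isDifferentiableOn
    isOpen_univ]
  refine ⟨fun z w _ => ?_, hc.continuousOn⟩
  rw [← add_eq_zero_iff_eq_neg, wedgeIntegral_add_wedgeIntegral_eq]
  -- Morera's theorem: the rectangle is cut along the imaginary axis. Each piece has its interior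
  -- off the axis, so Cauchy–Goursat applies with mere continuity on the boundary, and the integrals
  -- along the cut cancel.
  have h1 := integral_boundary_rect_eq_zero_of_continuousOn_of_differentiableOn f z
    (w.im * I) hc.continuousOn (fun p hp => (hd p (by
      have := hp.1
      rcases le_total z.re 0 with h | h
      · simp [h] at this; exact this.2.ne
      · simp [h] at this; exact this.1.ne')).differentiableWithinAt)
  have h2 := integral_boundary_rect_eq_zero_of_continuousOn_of_differentiableOn f (z.im * I) w
    hc.continuousOn (fun p hp => (hd p (by
      have := hp.1
      rcases le_total w.re 0 with h | h
      · simp [h] at this; exact this.2.ne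
      · simp [h] at this; exact this.1.ne')).differentiableWithinAt)
  simp only [mul_re, ofReal_re, I_re, mul_zero, ofReal_im, I_im, mul_one, sub_self, mul_im,
    zero_add, add_zero, ofReal_zero, zero_add] at h1 h2
  have i1 : ∀ (c : ℂ) (a b : ℝ), IntervalIntegrable (fun x : ℝ => f (x + c)) MeasureTheory.volume
      a b := fun c a b => Continuous.intervalIntegrable (by fun_prop) a b
  rw [← intervalIntegral.integral_add_adjacent_intervals (i1 (z.im * I) z.re 0) (i1 _ 0 w.re),
    ← intervalIntegral.integral_add_adjacent_intervals (i1 (w.im * I) z.re 0) (i1 _ 0 w.re)]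
  linear_combination h1 + h2

/-- An entire function whose real part has the sign of `Re p` is, up to its value at `0`, linear. -/
theorem exists_linear_of_re_sign {g : ℂ → ℂ} (hg : Differentiable ℂ g) (h0 : g 0 = 0)
    (hpos : ∀ p : ℂ, 0 ≤ p.re → 0 ≤ (g p).re) (hneg : ∀ p : ℂ, p.re ≤ 0 → (g p).re ≤ 0) :
    ∃ α : ℂ, 0 ≤ α.re ∧ ∀ p, g p = α * p := by
  have hk : Differentiable ℂ (dslope g 0) := by
    rw [← differentiableOn_univ, differentiableOn_dslope univ_mem]
    exact hg.differentiableOn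
  set k := dslope g 0 with hkdef
  have hgk : ∀ p, g p = k p * p := by
    intro p
    have := sub_smul_dslope g 0 p
    simp only [sub_zero, smul_eq_mul, h0] at this
    rw [← this, mul_comm]
  -- On `|p| = R` one has `R² = p conj p`, so `k(p)(R² + p²) = 2 (Re p) g(p)`, whose real part is
  -- nonnegative by the sign hypotheses. The maximum principle for `exp(-·)` extends this to the
  -- disc.
  have hsphere : ∀ R : ℝ, 0 < R → ∀ p : ℂ, ‖p‖ ≤ R → 0 ≤ (k p * (R ^ 2 + p ^ 2)).re := by
    intro R hR p hp
    have hd : Differentiable ℂ fun p => Complex.exp (-(k p * (R ^ 2 + p ^ 2))) := by fun_prop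
    have hb : ∀ z ∈ frontier (Metric.ball (0 : ℂ) R),
        ‖Complex.exp (-(k z * (R ^ 2 + z ^ 2)))‖ ≤ 1 := by
      intro z hz
      rw [frontier_ball _ hR.ne', mem_sphere_zero_iff_norm] at hz
      have e : k z * (R ^ 2 + z ^ 2) = g z * ((2 * z.re : ℝ) : ℂ) := by
        have e1 : ((R : ℂ)) ^ 2 = z * conj z := by
          rw [Complex.mul_conj, Complex.normSq_eq_norm_sq, hz]; push_cast; ring
        have e2 : ((2 * z.re : ℝ) : ℂ) = z + conj z := by rw [Complex.add_conj]
        rw [e1, e2, hgk]; ring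
      rw [Complex.norm_exp, Real.exp_le_one_iff, neg_re, e, re_mul_ofReal, neg_nonpos]
      rcases le_total 0 z.re with h | h
      · exact mul_nonneg (hpos z h) (by linarith)
      · exact mul_nonneg_of_nonpos_of_nonpos (hneg z h) (by linarith)
    have := Complex.norm_le_of_forall_mem_frontier_norm_le Metric.isBounded_ball
      hd.diffContOnCl hb (z := p) (by rw [closure_ball _ hR.ne']; simpa using hp)
    rw [Complex.norm_exp, Real.exp_le_one_iff, neg_re, neg_nonpos] at this
    exact this
  -- Divide the previous inequality by `R²` and let `R → ∞`; Liouville then applies to `exp(-k)`.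
  have hkre : ∀ p, 0 ≤ (k p).re := by
    intro p
    have ht : Tendsto (fun R : ℝ => (k p * (1 + p ^ 2 * ((R ^ 2 : ℝ) : ℂ)⁻¹)).re) atTop
        (𝓝 (k p * (1 + p ^ 2 * 0)).re) := by
      have h1 : Tendsto (fun R : ℝ => ((R ^ 2 : ℝ) : ℂ)⁻¹) atTop (𝓝 0) := by
        have : Tendsto (fun R : ℝ => (R ^ 2)⁻¹) atTop (𝓝 0) :=
          (tendsto_pow_atTop two_ne_zero).inv_tendsto_atTop
        have := (Complex.continuous_ofReal.tendsto 0).comp this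
        simpa [Function.comp_def] using this
      exact (Complex.continuous_re.tendsto _).comp ((((h1.const_mul _).const_add 1)).const_mul _)
    simp only [mul_zero, add_zero, mul_one] at ht
    refine ge_of_tendsto ht ?_
    filter_upwards [eventually_ge_atTop ‖p‖, eventually_gt_atTop 0] with R hR hR0
    have := hsphere R hR0 p hR
    have e : k p * (1 + p ^ 2 * ((R ^ 2 : ℝ) : ℂ)⁻¹)
        = ((R ^ 2)⁻¹ : ℝ) * (k p * (R ^ 2 + p ^ 2)) := by
      have : (R : ℂ) ≠ 0 := by exact_mod_cast hR0.ne'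
      push_cast
      field_simp
    rw [e, re_ofReal_mul]
    positivity
  obtain ⟨c, hc⟩ := (show Differentiable ℂ fun p => Complex.exp (-k p) by
    fun_prop).exists_const_forall_eq_of_bounded (by
      refine (Metric.isBounded_closedBall (x := (0 : ℂ)) (r := 1)).subset ?_
      rintro _ ⟨p, rfl⟩
      simp [Complex.norm_exp, hkre p])
  have hder : ∀ p, deriv k p = 0 := by
    intro p
    have h1 : HasDerivAt (fun p => Complex.exp (-k p)) (Complex.exp (-k p) * -deriv k p) p :=
      (hk p).hasDerivAt.neg.cexp
    have h2 : HasDerivAt (fun p => Complex.exp (-k p)) 0 p := by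
      simp only [hc]; exact hasDerivAt_const p c
    simpa [Complex.exp_ne_zero] using h1.unique h2
  refine ⟨k 0, hkre 0, fun p => ?_⟩
  rw [hgk, is_const_of_deriv_eq_zero hk hder p 0]

/-- A nonvanishing entire function has an entire logarithm. -/
theorem exists_entire_log {f : ℂ → ℂ} (hf : Differentiable ℂ f) (h0 : ∀ p, f p ≠ 0) :
    ∃ h : ℂ → ℂ, Differentiable ℂ h ∧ h 0 = 0 ∧ ∀ p, f p = f 0 * Complex.exp (h p) := by
  have hL : Differentiable ℂ fun p => deriv f p / f p := fun p =>
    ((hf.contDiff (n := 2)).differentiable_deriv_two p).div (hf p) (h0 p)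
  obtain ⟨h, hh0, hh⟩ := hL.isExactOn_univ.with_val_at 0 0
  have hd : ∀ p, HasDerivAt (fun p => f p * Complex.exp (-h p)) 0 p := by
    intro p
    have := (hf p).hasDerivAt.mul (hh p (mem_univ p)).neg.cexp
    refine this.congr_deriv ?_
    have := h0 p
    field_simp
    ring
  refine ⟨h, fun p => (hh p (mem_univ p)).differentiableAt, hh0, fun p => ?_⟩
  have := is_const_of_deriv_eq_zero (fun p => (hd p).differentiableAt) (fun p => (hd p).deriv) p 0
  simp only [hh0, neg_zero, Complex.exp_zero, mul_one] at this
  rw [← this, mul_assoc, ← Complex.exp_add]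
  simp

/-- A zero-free inner function of the right half-plane, continuous up to the boundary. -/
theorem exists_eq_exp_of_nonvanishing {G : ℂ → ℂ} (hc : ContinuousOn G closedRightHalfPlane)
    (hd : DifferentiableOn ℂ G rightHalfPlane) (h0 : ∀ p ∈ rightHalfPlane, G p ≠ 0)
    (hle : ∀ p ∈ rightHalfPlane, ‖G p‖ ≤ 1) (haxis : ∀ p : ℂ, p.re = 0 → ‖G p‖ = 1)
    (hreal : conj (G 0) = G 0) :
    ∃ ε a : ℝ, (ε = 1 ∨ ε = -1) ∧ 0 ≤ a ∧
      ∀ p ∈ closedRightHalfPlane, G p = ε * Complex.exp (-a * p) := by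
  classical
  -- Schwarz reflection in the imaginary axis and the unit circle; the two branches agree on the
  -- axis because `|G| = 1` there.
  let E : ℂ → ℂ := fun p => if 0 ≤ p.re then G p else (conj (G (-conj p)))⁻¹
  have hne : ∀ p ∈ closedRightHalfPlane, G p ≠ 0 := by
    intro p hp
    rcases (show 0 ≤ p.re from hp).eq_or_lt with h | h
    · intro h'; have := haxis p h.symm; simp [h'] at this
    · exact h0 p h
  have hle' : ∀ p ∈ closedRightHalfPlane, ‖G p‖ ≤ 1 := by
    intro p hp
    rcases (show 0 ≤ p.re from hp).eq_or_lt with h | h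
    · exact (haxis p h.symm).le
    · exact hle p h
  have hEr : ∀ p : ℂ, 0 ≤ p.re → E p = G p := fun p hp => if_pos hp
  have hEl : ∀ p : ℂ, p.re ≤ 0 → E p = (conj (G (-conj p)))⁻¹ := by
    intro p hp
    rcases hp.eq_or_lt with h | h
    · have e : -conj p = p := by apply Complex.ext <;> simp [h]
      rw [hEr p h.ge, e]
      apply eq_inv_of_mul_eq_one_left
      rw [Complex.mul_conj, Complex.normSq_eq_norm_sq, haxis p h]
      simp
    · exact if_neg (not_le.2 h)
  have hmem : ∀ p : ℂ, p.re ≤ 0 → -conj p ∈ closedRightHalfPlane := by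
    intro p hp; simpa [closedRightHalfPlane] using hp
  have hEc : Continuous E := by
    rw [← continuousOn_univ]
    have hu : (univ : Set ℂ) = closedRightHalfPlane ∪ {p | p.re ≤ 0} := by
      ext p; simp [closedRightHalfPlane, le_total]
    rw [hu]
    refine ContinuousOn.union_of_isClosed (hc.congr fun p hp => hEr p hp) ?_
      isClosed_closedRightHalfPlane (isClosed_le Complex.continuous_re continuous_const)
    refine ContinuousOn.congr ?_ (fun p hp => hEl p hp)
    refine ContinuousOn.inv₀ ?_ (fun p hp => by simpa using hne _ (hmem p hp))
    exact Complex.continuous_conj.comp_continuousOn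
      (hc.comp Complex.continuous_conj.neg.continuousOn fun p hp => hmem p hp)
  have hEd : Differentiable ℂ E := by
    refine differentiable_of_continuous_of_differentiableAt_off_axis hEc fun p hp => ?_
    rcases hp.lt_or_gt with h | h
    · have hm' : -conj p ∈ rightHalfPlane := by simpa [rightHalfPlane] using h
      have h1 : DifferentiableAt ℂ (fun p => conj (G (-conj p))) p := by
        have h2 : DifferentiableAt ℂ (fun p => G (-p)) (conj p) :=
          DifferentiableAt.comp (conj p) (g := G)
            (hd.differentiableAt (isOpen_rightHalfPlane.mem_nhds hm')) (by fun_prop)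
        simpa [Function.comp_def] using h2.conj_conj
      refine (h1.inv (by simpa using h0 _ hm')).congr_of_eventuallyEq ?_
      filter_upwards [(isOpen_lt Complex.continuous_re continuous_const).mem_nhds h] with z hz
      exact hEl z (le_of_lt hz)
    · refine (hd.differentiableAt (isOpen_rightHalfPlane.mem_nhds h)).congr_of_eventuallyEq ?_
      filter_upwards [isOpen_rightHalfPlane.mem_nhds h] with z hz
      exact hEr z (le_of_lt hz)
  have hE0 : ∀ p, E p ≠ 0 := by
    intro p
    rcases le_total 0 p.re with h | h
    · rw [hEr p h]; exact hne p h
    · rw [hEl p h]; simpa using hne _ (hmem p h)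
  obtain ⟨h, hhd, hh0, hh⟩ := exists_entire_log hEd hE0
  have hE00 : ‖E 0‖ = 1 := by rw [hEr 0 le_rfl]; exact haxis 0 rfl
  have hnorm : ∀ p, ‖E p‖ = Real.exp (h p).re := by
    intro p; rw [hh p, norm_mul, hE00, one_mul, Complex.norm_exp]
  obtain ⟨α, hα, hlin⟩ := exists_linear_of_re_sign hhd.neg (by simp [hh0])
    (fun p hp => by
      have := hle' p hp
      rw [← hEr p hp, hnorm, Real.exp_le_one_iff] at this
      simpa using this)
    (fun p hp => by
      have h1 := hle' _ (hmem p hp)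
      have h2 := hnorm p
      rw [hEl p hp, norm_inv, RCLike.norm_conj] at h2
      have h3 : 1 ≤ Real.exp (h p).re := by
        rw [← h2]
        exact (one_le_inv₀ (norm_pos_iff.2 (hne _ (hmem p hp)))).2 h1
      simpa using h3)
  have hGe : ∀ p ∈ closedRightHalfPlane, G p = G 0 * Complex.exp (-α * p) := by
    intro p hp
    rw [← hEr p hp, hh p, hEr 0 le_rfl, neg_mul, ← hlin p]
    simp
  -- At `p = i` the exponential has modulus `exp(Im α)`, and it must be 1.
  have hαim : α.im = 0 := by
    have h1 := haxis I rfl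
    rw [hGe I (by simp [closedRightHalfPlane]), norm_mul, haxis 0 rfl, one_mul, Complex.norm_exp,
      Real.exp_eq_one_iff] at h1
    simpa using h1
  obtain ⟨ε, hε⟩ := Complex.conj_eq_iff_real.1 hreal
  refine ⟨ε, α.re, ?_, hα, fun p hp => ?_⟩
  · have := haxis 0 rfl
    rw [hε, Complex.norm_real, Real.norm_eq_abs] at this
    exact eq_or_eq_neg_of_abs_eq this
  · rw [hGe p hp, hε]
    congr 3
    apply Complex.ext <;> simp [hαim]

/-! ### Dividing out zeros without losing the bound 1. -/

/-- The Schwarz lemma in the right half-plane: division by a Blaschke factor. -/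
theorem exists_eq_blaschke_mul {F : ℂ → ℂ} {z : ℂ} (hd : DifferentiableOn ℂ F rightHalfPlane)
    (hle : ∀ p ∈ rightHalfPlane, ‖F p‖ ≤ 1) (hz : z ∈ rightHalfPlane) (h0 : F z = 0) :
    ∃ Φ : ℂ → ℂ, DifferentiableOn ℂ Φ rightHalfPlane ∧ (∀ p ∈ rightHalfPlane, ‖Φ p‖ ≤ 1) ∧
      ∀ p ∈ rightHalfPlane, F p = (z - p) / (conj z + p) * Φ p := by
  have hz' : 0 < z.re := hz
  have hzc : 0 < (conj z).re := by simpa using hz'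
  have hnhds : rightHalfPlane ∈ 𝓝 z := isOpen_rightHalfPlane.mem_nhds hz
  have hs : DifferentiableOn ℂ (dslope F z) rightHalfPlane :=
    (differentiableOn_dslope hnhds).2 hd
  have hFs : ∀ p, F p = (p - z) * dslope F z p := by
    intro p
    have := sub_smul_dslope F z p
    simp only [smul_eq_mul, h0, sub_zero] at this
    exact this.symm
  -- Using `dslope` makes the quotient holomorphic at `z` as well; its bound there follows by
  -- continuity from the punctured neighbourhood.
  set Φ : ℂ → ℂ := fun p => -(conj z + p) * dslope F z p with hΦ
  have hΦd : DifferentiableOn ℂ Φ rightHalfPlane := DifferentiableOn.mul (by fun_prop) hs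
  have hFΦ : ∀ p ∈ rightHalfPlane, F p = (z - p) / (conj z + p) * Φ p := by
    intro p hp
    have := add_ne_zero_of_mem hzc (le_of_lt hp)
    rw [hFs p, hΦ]
    field_simp
    ring
  have hschwarz : ∀ p ∈ rightHalfPlane, ‖F p‖ ≤ ‖(z - p) / (conj z + p)‖ := by
    intro p hp
    -- The inverse of the Cayley map `p ↦ (z - p) / (conj z + p)`, which carries the half-plane to
    -- the unit disc and `z` to 0; the usual Schwarz lemma is applied there.
    have hcay : ∀ u ∈ Metric.ball (0 : ℂ) 1, 1 + u ≠ 0 ∧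
        (z - conj z * u) / (1 + u) ∈ rightHalfPlane := by
      intro u hu
      rw [mem_ball_zero_iff] at hu
      have hu1 : 1 + u ≠ 0 := by
        intro h
        have : u = -1 := by linear_combination h
        simp [this] at hu
      refine ⟨hu1, ?_⟩
      have hnn : 0 < Complex.normSq (1 + u) := Complex.normSq_pos.2 hu1
      have e : ((z - conj z * u) / (1 + u)).re
          = z.re * (1 - Complex.normSq u) / Complex.normSq (1 + u) := by
        rw [Complex.div_re, ← add_div]
        congr 1
        simp [Complex.normSq_apply]
        ring
      rw [rightHalfPlane, mem_ofPred_eq, e]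
      have : Complex.normSq u < 1 := by
        rw [Complex.normSq_eq_norm_sq]
        nlinarith [norm_nonneg u]
      exact div_pos (mul_pos hz' (by linarith)) hnn
    have hp0 := add_ne_zero_of_mem hzc (le_of_lt hp)
    have hlt : ‖(z - p) / (conj z + p)‖ < 1 := by
      rw [norm_div, div_lt_one (norm_pos_iff.2 hp0)]
      have h1 := norm_bFactor_mul_conj (q := z) (p := p)
      have h2 : 0 < 4 * z.re * p.re := by have : 0 < p.re := hp; positivity
      exact (sq_lt_sq₀ (norm_nonneg _) (norm_nonneg _)).1 (by linarith)
    have key := Complex.norm_le_norm_of_mapsTo_ball (R := 1)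
      (f := fun u => F ((z - conj z * u) / (1 + u))) (z := (z - p) / (conj z + p))
      (hd.comp (DifferentiableOn.div (by fun_prop) (by fun_prop) fun u hu => (hcay u hu).1)
        fun u hu => (hcay u hu).2)
      (fun u hu => by simpa using hle _ (hcay u hu).2) (by simpa using h0) hlt
    have e : (z - conj z * ((z - p) / (conj z + p))) / (1 + (z - p) / (conj z + p)) = p := by
      have h1 : 1 + (z - p) / (conj z + p) ≠ 0 :=
        (hcay _ (by simpa using hlt)).1
      rw [div_eq_iff h1]
      field_simp
      ring
    simpa only [e] using key
  refine ⟨Φ, hΦd, ?_, hFΦ⟩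
  have hoff : ∀ p ∈ rightHalfPlane, p ≠ z → ‖Φ p‖ ≤ 1 := by
    intro p hp hpz
    have h1 := hschwarz p hp
    have h2 : 0 < ‖(z - p) / (conj z + p)‖ := norm_pos_iff.2
      (div_ne_zero (sub_ne_zero.2 hpz.symm) (add_ne_zero_of_mem hzc (le_of_lt hp)))
    rw [hFΦ p hp, norm_mul] at h1
    exact le_of_mul_le_mul_left (by linarith) h2
  intro p hp
  by_cases hpz : p = z
  · subst hpz
    have hcont : ContinuousAt Φ p := (hΦd.differentiableAt hnhds).continuousAt
    refine le_of_tendsto ((hcont.tendsto.mono_left nhdsWithin_le_nhds).norm : Tendsto _ (𝓝[≠] p) _) ?_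
    filter_upwards [self_mem_nhdsWithin, mem_nhdsWithin_of_mem_nhds hnhds] with u hu hu'
    exact hoff u hu' hu
  · exact hoff p hp hpz

/-- Division by a symmetric factor. -/
theorem exists_eq_bPair_mul {F : ℂ → ℂ} {z : ℂ} (hd : DifferentiableOn ℂ F rightHalfPlane)
    (hle : ∀ p ∈ rightHalfPlane, ‖F p‖ ≤ 1) (hz : z ∈ rightHalfPlane)
    (h0 : F z = 0) (h0' : F (conj z) = 0) :
    ∃ Φ : ℂ → ℂ, DifferentiableOn ℂ Φ rightHalfPlane ∧ (∀ p ∈ rightHalfPlane, ‖Φ p‖ ≤ 1) ∧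
      ∀ p ∈ rightHalfPlane, F p = bPair z p * Φ p := by
  have hz' : 0 < z.re := hz
  have hzc : conj z ∈ rightHalfPlane := by simpa [rightHalfPlane] using hz'
  unfold bPair bFactor
  split_ifs with h1 h2
  · simpa [Complex.conj_eq_iff_im.2 h1] using exists_eq_blaschke_mul hd hle hz h0
  · obtain ⟨Φ, hΦd, hΦle, hΦ⟩ := exists_eq_blaschke_mul hd hle hz h0
    have hΦ0 : Φ (conj z) = 0 := by
      have := hΦ _ hzc
      rw [h0', eq_comm, mul_eq_zero] at this
      refine this.resolve_left (div_ne_zero ?_ (add_ne_zero_of_mem hzc (le_of_lt hzc)))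
      intro h
      have := congrArg Complex.im h
      simp at this
      exact h1 this
    obtain ⟨Ψ, hΨd, hΨle, hΨ⟩ := exists_eq_blaschke_mul hΦd hΦle hzc hΦ0
    refine ⟨Ψ, hΨd, hΨle, fun p hp => ?_⟩
    -- The Blaschke factors at `z` and `conj z` have the two denominators of `bPair` interchanged;
    -- the products coincide.
    rw [hΦ p hp, hΨ p hp, Complex.conj_conj]
    have e1 := add_ne_zero_of_mem hz (le_of_lt hp)
    have e2 := add_ne_zero_of_mem hzc (le_of_lt hp)
    field_simp
  · exact ⟨F, hd, hle, by simp⟩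

/-! ### Orders of vanishing of the symmetric factors. -/

open Classical in
/-- The representative of `{w, conj w}` in the closed lower half-plane. -/
noncomputable def lowerRep (w : ℂ) : ℂ := if w.im ≤ 0 then w else conj w

lemma lowerRep_im_nonpos (w : ℂ) : (lowerRep w).im ≤ 0 := by
  unfold lowerRep
  split_ifs with h
  · exact h
  · simpa using (not_le.1 h).le

lemma lowerRep_of_im_nonpos {w : ℂ} (h : w.im ≤ 0) : lowerRep w = w := if_pos h

lemma lowerRep_conj_of_im_nonpos {w : ℂ} (h : w.im ≤ 0) : lowerRep (conj w) = w := by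
  unfold lowerRep
  split_ifs with h'
  · simp at h'
    exact Complex.conj_eq_iff_im.2 (le_antisymm h h')
  · simp

lemma analyticAt_of_differentiableOn_rightHalfPlane {F : ℂ → ℂ}
    (hd : DifferentiableOn ℂ F rightHalfPlane) {w : ℂ} (hw : w ∈ rightHalfPlane) :
    AnalyticAt ℂ F w :=
  hd.analyticAt (isOpen_rightHalfPlane.mem_nhds hw)

lemma analyticAt_bFactor {q w : ℂ} (hq : q ∈ rightHalfPlane) (hw : w ∈ rightHalfPlane) :
    AnalyticAt ℂ (bFactor q) w :=
  analyticAt_of_differentiableOn_rightHalfPlane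
    (fun _ hp => (differentiableAt_bFactor hq (le_of_lt hp)).differentiableWithinAt) hw

lemma analyticAt_bPair {q w : ℂ} (hq : q ∈ rightHalfPlane) (hw : w ∈ rightHalfPlane) :
    AnalyticAt ℂ (bPair q) w :=
  analyticAt_of_differentiableOn_rightHalfPlane
    (fun _ hp => (differentiableAt_bPair hq (le_of_lt hp)).differentiableWithinAt) hw

open Classical in
lemma analyticOrderAt_bFactor {q w : ℂ} (hq : q ∈ rightHalfPlane) (hw : w ∈ rightHalfPlane) :
    analyticOrderAt (bFactor q) w = if w = q then 1 else 0 := by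
  have hne := add_ne_zero_of_mem hq (le_of_lt hw)
  split_ifs with h
  · subst h
    refine ((analyticAt_bFactor hq hw).analyticOrderAt_eq_natCast (n := 1)).2
      ⟨fun p => -(w + p)⁻¹, ?_, by simpa using hne, Eventually.of_forall fun p => ?_⟩
    · exact ((analyticAt_const.add analyticAt_id).inv hne).neg
    · simp only [bFactor, div_eq_mul_inv, pow_one, smul_eq_mul]
      ring
  · rw [(analyticAt_bFactor hq hw).analyticOrderAt_eq_zero]
    exact div_ne_zero (sub_ne_zero.2 (Ne.symm h)) hne

-- Only points of the closed lower half-plane carry zeros, each at itself and at its conjugate.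
-- Hence a zero at `w` is counted by the indices whose value is `lowerRep w`, not `w`.
open Classical in
lemma analyticOrderAt_bPair {q w : ℂ} (hq : q ∈ rightHalfPlane) (hw : w ∈ rightHalfPlane) :
    analyticOrderAt (bPair q) w = if lowerRep w = q then 1 else 0 := by
  have hqc : conj q ∈ rightHalfPlane := by simpa [rightHalfPlane] using hq
  have hiff : q.im ≤ 0 → (lowerRep w = q ↔ w = q ∨ w = conj q) := by
    intro hi
    constructor
    · rintro rfl
      unfold lowerRep
      split_ifs <;> simp
    · rintro (rfl | rfl)
      · exact lowerRep_of_im_nonpos hi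
      · exact lowerRep_conj_of_im_nonpos hi
  rcases lt_trichotomy q.im 0 with h | h | h
  · have e : bPair q = bFactor q * bFactor (conj q) := by
      funext p; simp [bPair, h, h.ne]
    have hqq : q ≠ conj q := fun h' => h.ne (Complex.conj_eq_iff_im.1 h'.symm)
    rw [e, analyticOrderAt_mul (analyticAt_bFactor hq hw) (analyticAt_bFactor hqc hw),
      analyticOrderAt_bFactor hq hw, analyticOrderAt_bFactor hqc hw]
    simp only [hiff h.le]
    by_cases h1 : w = q
    · simp [h1, hqq]
    · simp [h1]
  · have e : bPair q = bFactor q := by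
      funext p; simp [bPair, h]
    rw [e, analyticOrderAt_bFactor hq hw]
    simp only [hiff h.le, Complex.conj_eq_iff_im.2 h, or_self]
  · have e : bPair q = fun _ => 1 := by
      funext p; simp [bPair, h.ne', h.le]
    have hne : lowerRep w ≠ q := by
      rintro rfl
      exact absurd (lowerRep_im_nonpos w) (not_le.2 h)
    rw [if_neg hne, e, analyticAt_const.analyticOrderAt_eq_zero]
    exact one_ne_zero

/-! ### Zeros of symmetric inner functions and the Blaschke condition. -/

/-- Inner functions of the right half-plane that are continuous up to the imaginary axis and
symmetric with respect to complex conjugation. -/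
structure IsSymmetricInner (F : ℂ → ℂ) : Prop where
  continuousOn : ContinuousOn F closedRightHalfPlane
  differentiableOn : DifferentiableOn ℂ F rightHalfPlane
  norm_le_one : ∀ p ∈ rightHalfPlane, ‖F p‖ ≤ 1
  norm_eq_one : ∀ p : ℂ, p.re = 0 → ‖F p‖ = 1
  apply_conj : ∀ p ∈ closedRightHalfPlane, F (conj p) = conj (F p)

lemma mem_rightHalfPlane_conj {w : ℂ} (hw : w ∈ rightHalfPlane) : conj w ∈ rightHalfPlane := by
  simpa [rightHalfPlane] using hw

namespace IsSymmetricInner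

variable {F : ℂ → ℂ} (hF : IsSymmetricInner F)
include hF

lemma analyticAt {w : ℂ} (hw : w ∈ rightHalfPlane) : AnalyticAt ℂ F w :=
  analyticAt_of_differentiableOn_rightHalfPlane hF.differentiableOn hw

/-- If `F(p) = (p - w)ⁿ g(p)` near `w`, then `conj ∘ g ∘ conj` is the corresponding cofactor near
`conj w`. -/
lemma analyticOrderAt_le_conj {w : ℂ} (hw : w ∈ rightHalfPlane) :
    analyticOrderAt F w ≤ analyticOrderAt F (conj w) := by
  have hwc := mem_rightHalfPlane_conj hw
  refine ENat.forall_natCast_le_iff_le.1 fun n hn => ?_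
  obtain ⟨g, hg, hgF⟩ := (natCast_le_analyticOrderAt (hF.analyticAt hw)).1 hn
  refine (natCast_le_analyticOrderAt (hF.analyticAt hwc)).2 ⟨fun p => conj (g (conj p)), ?_, ?_⟩
  · rw [Complex.analyticAt_iff_eventually_differentiableAt] at hg ⊢
    have hc : Tendsto (fun p : ℂ => conj p) (𝓝 (conj w)) (𝓝 w) := by
      simpa using (Complex.continuous_conj.tendsto (conj w))
    filter_upwards [hc.eventually hg] with p hp
    simpa [Function.comp_def] using hp.conj_conj
  · have hc : Tendsto (fun p : ℂ => conj p) (𝓝 (conj w)) (𝓝 w) := by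
      simpa using (Complex.continuous_conj.tendsto (conj w))
    filter_upwards [hc.eventually hgF, isOpen_rightHalfPlane.mem_nhds hwc] with p hp hp'
    have := hF.apply_conj _ (rightHalfPlane_subset (mem_rightHalfPlane_conj hp'))
    rw [Complex.conj_conj, hp] at this
    simpa using this

lemma analyticOrderAt_conj {w : ℂ} (hw : w ∈ rightHalfPlane) :
    analyticOrderAt F (conj w) = analyticOrderAt F w :=
  le_antisymm (by simpa using hF.analyticOrderAt_le_conj (mem_rightHalfPlane_conj hw))
    (hF.analyticOrderAt_le_conj hw)

lemma analyticOrderAt_lowerRep {w : ℂ} (hw : w ∈ rightHalfPlane) :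
    analyticOrderAt F (lowerRep w) = analyticOrderAt F w := by
  unfold lowerRep
  split_ifs
  · rfl
  · exact hF.analyticOrderAt_conj hw

/-- Continuity at 0, where `|F| = 1`. The point excludes `F = 0` in the identity theorem and is
later the base point for the Blaschke sum. -/
lemma exists_real_ne_zero : ∃ t : ℝ, 0 < t ∧ F t ≠ 0 := by
  have h0 : F 0 ≠ 0 := by
    intro h
    have := hF.norm_eq_one 0 rfl
    simp [h] at this
  have h1 : Tendsto (fun t : ℝ => F t) (𝓝[>] 0) (𝓝 (F 0)) := by
    refine (hF.continuousOn 0 (by simp [closedRightHalfPlane])).tendsto.comp ?_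
    refine tendsto_nhdsWithin_iff.2 ⟨?_, ?_⟩
    · have := (Complex.continuous_ofReal.tendsto 0).mono_left
        (nhdsWithin_le_nhds (s := Ioi (0 : ℝ)))
      simpa using this
    · filter_upwards [self_mem_nhdsWithin] with t ht
      simpa [closedRightHalfPlane] using (le_of_lt ht : (0 : ℝ) ≤ t)
  obtain ⟨t, ht, ht0⟩ := ((h1.eventually_ne h0).and self_mem_nhdsWithin).exists
  exact ⟨t, ht0, ht⟩

lemma analyticOrderAt_ne_top {w : ℂ} (hw : w ∈ rightHalfPlane) : analyticOrderAt F w ≠ ⊤ := by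
  obtain ⟨t, ht, htF⟩ := hF.exists_real_ne_zero
  have htm : (t : ℂ) ∈ rightHalfPlane := by simpa [rightHalfPlane] using ht
  have hconn : IsPreconnected rightHalfPlane := (convex_halfSpace_re_gt 0).isPreconnected
  refine AnalyticOnNhd.analyticOrderAt_ne_top_of_isPreconnected
    (fun p hp => hF.analyticAt hp) hconn htm hw ?_
  rw [(hF.analyticAt htm).analyticOrderAt_eq_zero.2 htF]
  exact ENat.zero_ne_top

/-- An accumulation point of zeros would be a zero by continuity. It cannot lie on the axis, where
`|F| = 1`, nor inside, by the identity theorem. -/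
lemma finite_zeros (R : ℝ) : {z | z ∈ rightHalfPlane ∧ F z = 0 ∧ ‖z‖ ≤ R}.Finite := by
  by_contra hinf
  have hK : IsCompact (closedRightHalfPlane ∩ Metric.closedBall 0 R) :=
    (isCompact_closedBall _ _).inter_left isClosed_closedRightHalfPlane
  obtain ⟨z, hz, hacc⟩ := Set.Infinite.exists_accPt_of_subset_isCompact hinf hK
    (fun z hz => ⟨rightHalfPlane_subset hz.1, by simpa using hz.2.2⟩)
  have hfr : ∃ᶠ u in 𝓝[≠] z, u ∈ rightHalfPlane ∧ F u = 0 :=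
    (accPt_iff_frequently_nhdsNE.1 hacc).mono fun u hu => ⟨hu.1, hu.2.1⟩
  have hFz : F z = 0 := by
    by_contra hne
    have hev : ∀ᶠ u in 𝓝[closedRightHalfPlane] z, F u ≠ 0 :=
      (hF.continuousOn z hz.1).eventually_ne hne
    rw [eventually_nhdsWithin_iff] at hev
    obtain ⟨u, hu, hu'⟩ := (hfr.and_eventually (hev.filter_mono nhdsWithin_le_nhds)).exists
    exact hu' (rightHalfPlane_subset hu.1) hu.2
  have hzm : z ∈ rightHalfPlane := by
    refine lt_of_le_of_ne (show 0 ≤ z.re from hz.1) fun h => ?_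
    have := hF.norm_eq_one z h.symm
    simp [hFz] at this
  refine hF.analyticOrderAt_ne_top hzm (analyticOrderAt_eq_top.2 ?_)
  exact (hF.analyticAt hzm).frequently_zero_iff_eventually_zero.1 (hfr.mono fun u hu => hu.2)

end IsSymmetricInner

/-- `q` lists the zeros of `F` in the right half-plane with multiplicity. -/
structure ListsZeros {ι : Type*} (F : ℂ → ℂ) (q : ι → ℂ) : Prop where
  mem : ∀ k, q k ∈ rightHalfPlane
  encard_eq : ∀ w ∈ rightHalfPlane, {k | q k = w}.encard = analyticOrderAt F w

namespace ListsZeros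

variable {ι : Type*} {F : ℂ → ℂ} {q : ι → ℂ} (hq : ListsZeros F q) (hF : IsSymmetricInner F)
include hq hF

-- The order count is part of the statement so that the induction can continue: it shows that the
-- cofactor still vanishes at the next listed zero.
open Classical in
theorem exists_eq_prod_mul (T : Finset ι) :
    ∃ Φ : ℂ → ℂ, DifferentiableOn ℂ Φ rightHalfPlane ∧ (∀ p ∈ rightHalfPlane, ‖Φ p‖ ≤ 1) ∧
      (∀ p ∈ rightHalfPlane, F p = (∏ k ∈ T, bPair (q k) p) * Φ p) ∧
      ∀ w ∈ rightHalfPlane, analyticOrderAt F w =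
        (T.filter fun k => lowerRep w = q k).card + analyticOrderAt Φ w := by
  induction T using Finset.induction_on with
  | empty => exact ⟨F, hF.differentiableOn, hF.norm_le_one, by simp, by simp⟩
  | insert j T hj ih =>
    obtain ⟨Φ, hΦd, hΦle, hΦ, hord⟩ := ih
    have hstep : ∃ Ψ : ℂ → ℂ, DifferentiableOn ℂ Ψ rightHalfPlane ∧
        (∀ p ∈ rightHalfPlane, ‖Ψ p‖ ≤ 1) ∧
        ∀ p ∈ rightHalfPlane, Φ p = bPair (q j) p * Ψ p := by
      rcases lt_or_ge 0 (q j).im with h | h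
      · exact ⟨Φ, hΦd, hΦle, by simp [bPair, h.ne', h.le]⟩
      -- The value `q j` occurs in `insert j T` once more than in `T`, yet no more often than the
      -- order of `F` there; so `Φ` has positive order.
      · have hzero : ∀ w ∈ rightHalfPlane, lowerRep w = q j → Φ w = 0 := by
          intro w hw hwq
          have h1 := hord w hw
          have h2 := hq.encard_eq (q j) (hq.mem j)
          rw [← hF.analyticOrderAt_lowerRep hw, hwq, ← h2] at h1
          have h3 : (((insert j T).filter fun k => q k = q j : Finset ι) : Set ι) ⊆
              {k | q k = q j} := by
            intro k hk; simpa using (Finset.mem_filter.1 hk).2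
          have h4 := Set.encard_le_encard h3
          rw [Set.encard_coe_eq_coe_finsetCard, h1, Finset.filter_insert, if_pos rfl,
            Finset.card_insert_of_notMem (by simp [hj])] at h4
          simp only [eq_comm (a := q j)] at h4
          by_contra hne
          rw [(analyticAt_of_differentiableOn_rightHalfPlane hΦd hw).analyticOrderAt_eq_zero.2
            hne, add_zero] at h4
          have := Nat.cast_le.1 h4
          omega
        exact exists_eq_bPair_mul hΦd hΦle (hq.mem j)
          (hzero _ (hq.mem j) (lowerRep_of_im_nonpos h))
          (hzero _ (mem_rightHalfPlane_conj (hq.mem j)) (lowerRep_conj_of_im_nonpos h))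
    obtain ⟨Ψ, hΨd, hΨle, hΨ⟩ := hstep
    refine ⟨Ψ, hΨd, hΨle, fun p hp => ?_, fun w hw => ?_⟩
    · rw [hΦ p hp, hΨ p hp, Finset.prod_insert hj]
      ring
    · have hev : Φ =ᶠ[𝓝 w] bPair (q j) * Ψ := by
        filter_upwards [isOpen_rightHalfPlane.mem_nhds hw] with p hp
        exact hΨ p hp
      rw [hord w hw, analyticOrderAt_congr hev, analyticOrderAt_mul (analyticAt_bPair (hq.mem j) hw)
        (analyticAt_of_differentiableOn_rightHalfPlane hΨd hw),
        analyticOrderAt_bPair (hq.mem j) hw, Finset.filter_insert, ← add_assoc]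
      congr 1
      split_ifs with h
      · rw [Finset.card_insert_of_notMem (by simp [hj])]
        simp
      · simp

lemma norm_le_prod (T : Finset ι) {p : ℂ} (hp : p ∈ rightHalfPlane) :
    ‖F p‖ ≤ ∏ k ∈ T, ‖bPair (q k) p‖ := by
  obtain ⟨Φ, _, hΦle, hΦ, _⟩ := hq.exists_eq_prod_mul hF T
  rw [hΦ p hp, norm_mul, ← norm_prod]
  exact mul_le_of_le_one_right (norm_nonneg _) (hΦle p hp)

lemma finite_norm_le (R : ℝ) : {k | ‖q k‖ ≤ R}.Finite := by
  have hsub : {k | ‖q k‖ ≤ R} ⊆ ⋃ z ∈ {z | z ∈ rightHalfPlane ∧ F z = 0 ∧ ‖z‖ ≤ R},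
      {k | q k = z} := by
    intro k hk
    refine mem_biUnion (x := q k) ⟨hq.mem k, ?_, hk⟩ rfl
    refine apply_eq_zero_of_analyticOrderAt_ne_zero ?_
    rw [← hq.encard_eq _ (hq.mem k), Set.encard_ne_zero]
    exact ⟨k, rfl⟩
  refine ((hF.finite_zeros R).biUnion fun z hz => ?_).subset hsub
  rw [← Set.encard_ne_top_iff, hq.encard_eq z hz.1]
  exact hF.analyticOrderAt_ne_top hz.1

/-- `bPair` ignores zeros above the real axis, so `summable_lower` handles only half of the list;
conjugating the list supplies the other half. -/
lemma comp_conj : ListsZeros F (fun k => conj (q k)) where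
  mem k := mem_rightHalfPlane_conj (hq.mem k)
  encard_eq w hw := by
    rw [← hF.analyticOrderAt_conj hw, ← hq.encard_eq _ (mem_rightHalfPlane_conj hw)]
    congr 1
    ext k
    constructor
    · rintro rfl; simp
    · intro h; simp [show q k = _ from h]

/-- Since `1 - x ≤ -log x`, the bound of `|F p|` by the finite products bounds every partial sum by
`-log |F p|`. -/
lemma summable_one_sub_norm {p : ℂ} (hp : p ∈ rightHalfPlane) (hp0 : F p ≠ 0) :
    Summable fun k => 1 - ‖bPair (q k) p‖ := by
  refine summable_of_sum_le (c := -Real.log ‖F p‖)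
    (fun k => sub_nonneg.2 (norm_bPair_le_one (hq.mem k) (le_of_lt hp))) fun T => ?_
  have h1 := hq.norm_le_prod hF T hp
  have h2 : 0 < ∏ k ∈ T, ‖bPair (q k) p‖ := (norm_pos_iff.2 hp0).trans_le h1
  have h3 : ∀ k ∈ T, 0 < ‖bPair (q k) p‖ := fun k hk =>
    (norm_nonneg _).lt_of_ne' (Finset.prod_ne_zero_iff.1 h2.ne' k hk)
  have h4 := Real.log_le_log (norm_pos_iff.2 hp0) h1
  rw [Real.log_prod fun k hk => (h3 k hk).ne'] at h4
  calc ∑ k ∈ T, (1 - ‖bPair (q k) p‖) ≤ ∑ k ∈ T, -Real.log ‖bPair (q k) p‖ :=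
        Finset.sum_le_sum fun k hk => by
          have := Real.log_le_sub_one_of_pos (h3 k hk)
          linarith
    _ ≤ _ := by rw [Finset.sum_neg_distrib]; linarith

-- At real `t > 0` the factor at `q` has squared modulus `r² = 1 - 4 t Re q / |q + t|²`, and it
-- dominates `bPair` in norm. With `|q + t| ≤ 2|q|` for `|q| > t` and `1 - r² ≤ 2(1 - r)`, this
-- gives the constant `2 / t`.
open Classical in
lemma summable_lower :
    Summable fun k => if (q k).im ≤ 0 then (q k).re / ‖q k‖ ^ 2 else 0 := by
  obtain ⟨t, ht, htF⟩ := hF.exists_real_ne_zero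
  have htm : (t : ℂ) ∈ rightHalfPlane := by simpa [rightHalfPlane] using ht
  refine ((hq.summable_one_sub_norm hF htm htF).mul_left (2 / t)).of_norm_bounded_eventually ?_
  filter_upwards [(hq.finite_norm_le hF t).compl_mem_cofinite] with k hk
  have hk' : t < ‖q k‖ := not_le.1 hk
  have hre : 0 < (q k).re := hq.mem k
  have hb := norm_bPair_le_one hre ht.le (p := t) (q := q k)
  split_ifs with him
  · have hne := add_ne_zero_of_mem hre (p := (t : ℂ)) (by simpa using ht.le)
    have hr1 : ‖(q k - t) / (q k + t)‖ ≤ 1 ∧ ‖bPair (q k) t‖ ≤ ‖(q k - t) / (q k + t)‖ := by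
      have hc : ‖conj (q k) + t‖ = ‖q k + t‖ := by
        rw [← RCLike.norm_conj (q k + t)]; simp
      have h1 : ‖(q k - t) / (q k + t)‖ ≤ 1 := by
        rw [norm_div, ← hc]
        exact div_le_one_of_le₀ (norm_sub_le_norm_conj_add hre (by simpa using ht.le))
          (norm_nonneg _)
      refine ⟨h1, ?_⟩
      unfold bPair bFactor
      split_ifs with h2 h3
      · exact le_rfl
      · rw [norm_mul]
        refine mul_le_of_le_one_right (norm_nonneg _) ?_
        have : (conj (q k) - t) / (conj (q k) + t) = conj ((q k - t) / (q k + t)) := by simp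
        rw [this, RCLike.norm_conj]
        exact h1
      · exact absurd (lt_of_le_of_ne him h2) h3
    obtain ⟨hr1, hr2⟩ := hr1
    have hsq : ‖(q k - t) / (q k + t)‖ ^ 2 = 1 - 4 * (q k).re * t / ‖q k + t‖ ^ 2 := by
      have h1 := norm_bFactor_mul_conj (q := q k) (p := t)
      have hc : ‖conj (q k) + t‖ = ‖q k + t‖ := by
        rw [← RCLike.norm_conj (q k + t)]; simp
      have h0 : ‖q k + t‖ ≠ 0 := norm_ne_zero_iff.2 hne
      rw [hc, ofReal_re] at h1
      rw [norm_div, div_pow, h1]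
      field_simp
    have hle : ‖q k + t‖ ≤ 2 * ‖q k‖ := by
      refine (norm_add_le _ _).trans ?_
      rw [Complex.norm_real, Real.norm_of_nonneg ht.le]
      linarith
    have hnn : 0 < ‖q k + t‖ := norm_pos_iff.2 hne
    have hqpos : 0 < ‖q k‖ := ht.trans hk'
    rw [Real.norm_of_nonneg (by positivity)]
    have h1 : (q k).re / ‖q k‖ ^ 2 ≤ 4 * (q k).re / ‖q k + t‖ ^ 2 := by
      rw [div_le_div_iff₀ (by positivity) (by positivity)]
      have : ‖q k + t‖ ^ 2 ≤ (2 * ‖q k‖) ^ 2 := by gcongr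
      nlinarith
    have h2 : 4 * (q k).re * t / ‖q k + t‖ ^ 2 ≤ 2 * (1 - ‖bPair (q k) t‖) := by
      have := norm_nonneg ((q k - t) / (q k + t))
      nlinarith
    calc (q k).re / ‖q k‖ ^ 2 ≤ 4 * (q k).re / ‖q k + t‖ ^ 2 := h1
      _ = t⁻¹ * (4 * (q k).re * t / ‖q k + t‖ ^ 2) := by field_simp
      _ ≤ t⁻¹ * (2 * (1 - ‖bPair (q k) t‖)) := by gcongr
      _ = _ := by ring
  · rw [norm_zero]
    exact mul_nonneg (by positivity) (sub_nonneg.2 hb)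

theorem isBlaschkeSeq : IsBlaschkeSeq q where
  re_pos := hq.mem
  finite := hq.finite_norm_le hF
  summable := by
    have h1 := hq.summable_lower hF
    have h2 := (hq.comp_conj hF).summable_lower hF
    refine (h1.add h2).of_nonneg_of_le (fun k => ?_) fun k => ?_
    · have : 0 < (q k).re := hq.mem k
      positivity
    · have : 0 < (q k).re := hq.mem k
      have h3 : 0 ≤ (q k).re / ‖q k‖ ^ 2 := by positivity
      simp only [Complex.conj_im, Complex.conj_re, RCLike.norm_conj]
      split_ifs <;> linarith

end ListsZeros

/-! ### Listing the zeros and the canonical factorization. -/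

theorem exists_seqIndex_equiv (ι : Type*) [Countable ι] :
    ∃ N : ℕ∞, Nonempty (SeqIndex N ≃ ι) := by
  cases finite_or_infinite ι with
  | inl h =>
    obtain ⟨n, ⟨e⟩⟩ := Finite.exists_equiv_fin ι
    exact ⟨n, ⟨((Equiv.subtypeEquivRight fun k => Nat.cast_lt).trans
      Fin.equivSubtype.symm).trans e.symm⟩⟩
  | inr h =>
    obtain ⟨e⟩ := nonempty_equiv_of_countable (α := ℕ) (β := ι)
    exact ⟨⊤, ⟨(Equiv.subtypeUnivEquiv fun k => ENat.natCast_lt_top k).trans e⟩⟩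

namespace IsSymmetricInner

variable {F : ℂ → ℂ} (hF : IsSymmetricInner F)
include hF

theorem exists_listsZeros : ∃ (N : ℕ∞) (q : SeqIndex N → ℂ), ListsZeros F q := by
  -- Each point is repeated as often as its order; non-zeros contribute the empty `Fin 0`. All
  -- orders are finite, so the natural-number version loses nothing.
  let I := Σ z : rightHalfPlane, Fin (analyticOrderNatAt F z)
  let q : I → ℂ := fun x => x.1
  have hq : ListsZeros F q := by
    refine ⟨fun x => x.1.2, fun w hw => ?_⟩
    have : {x : I | q x = w} = range (Sigma.mk (⟨w, hw⟩ : rightHalfPlane)) := by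
      ext ⟨⟨z, hz⟩, j⟩
      constructor
      · rintro rfl
        exact ⟨j, rfl⟩
      · rintro ⟨i, hi⟩
        exact congrArg q hi.symm
    rw [this, ← Set.image_univ, sigma_mk_injective.injOn.encard_image, Set.encard_univ]
    simp [Nat.cast_analyticOrderNatAt (hF.analyticOrderAt_ne_top hw)]
  have hcount : Countable I := by
    rw [← Set.countable_univ_iff]
    have : (univ : Set I) = ⋃ n : ℕ, {k | ‖q k‖ ≤ n} := by
      ext k
      simpa using exists_nat_ge ‖q k‖
    rw [this]
    exact Set.countable_iUnion fun n => (hq.finite_norm_le hF n).countable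
  obtain ⟨N, ⟨e⟩⟩ := exists_seqIndex_equiv I
  refine ⟨N, q ∘ e, fun k => hq.mem _, fun w hw => ?_⟩
  rw [← hq.encard_eq w hw, ← e.injective.injOn.encard_image]
  congr 1
  ext x
  constructor
  · rintro ⟨k, hk, rfl⟩; exact hk
  · intro hx; exact ⟨e.symm x, by simpa using hx, by simp⟩

variable {ι : Type*} {q : ι → ℂ} (hq : ListsZeros F q)
include hq

lemma norm_le_norm_bProd {p : ℂ} (hp : p ∈ rightHalfPlane) : ‖F p‖ ≤ ‖bProd q p‖ :=
  ge_of_tendsto ((hq.isBlaschkeSeq hF).hasProd (rightHalfPlane_subset hp)).norm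
    (Eventually.of_forall fun T => hq.norm_le_prod hF T hp)

/-- Let `T` be the indices with value `lowerRep w`. Then `F = P Φ` and `bProd q = P R` with the same
finite product `P` over `T`, and neither `Φ` nor `R` vanishes at `w`. The orders are compared
through `bProd q * Φ = F * R`. -/
lemma analyticOrderAt_bProd {w : ℂ} (hw : w ∈ rightHalfPlane) :
    analyticOrderAt (bProd q) w = analyticOrderAt F w := by
  classical
  have hB := hq.isBlaschkeSeq hF
  have hfin : {k | q k = lowerRep w}.Finite :=
    (hB.finite ‖lowerRep w‖).subset fun k hk => by simp [show q k = _ from hk]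
  have hlw : lowerRep w ∈ rightHalfPlane := by
    unfold lowerRep
    split_ifs
    · exact hw
    · exact mem_rightHalfPlane_conj hw
  set T := hfin.toFinset with hT
  obtain ⟨Φ, hΦd, -, hΦ, hord⟩ := hq.exists_eq_prod_mul hF T
  have hfilter : T.filter (fun k => lowerRep w = q k) = T := by
    refine Finset.filter_true_of_mem fun k hk => ?_
    simpa [hT, eq_comm] using hk
  have hcard : (T.card : ℕ∞) = analyticOrderAt F w := by
    rw [← hF.analyticOrderAt_lowerRep hw, ← hq.encard_eq _ hlw, hfin.encard_eq_coe_toFinset_card]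
  have hΦan := analyticAt_of_differentiableOn_rightHalfPlane hΦd hw
  have hΦ0 : analyticOrderAt Φ w = 0 := by
    have := hord w hw
    rw [hfilter, ← hcard] at this
    exact (ENat.addLECancellable_of_ne_top (ENat.natCast_ne_top T.card)).inj.1
      (by rw [add_zero]; exact this.symm)
  have hsub : IsBlaschkeSeq fun k : {k // k ∉ T} => q k := hB.subtype {k | k ∉ T}
  have hRan := analyticAt_of_differentiableOn_rightHalfPlane hsub.differentiableOn hw
  have hR0 : analyticOrderAt (bProd fun k : {k // k ∉ T} => q k) w = 0 := by
    refine hRan.analyticOrderAt_eq_zero.2 (hsub.ne_zero (rightHalfPlane_subset hw) ?_)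
    rintro ⟨k, hk⟩
    rw [← (analyticAt_bPair (hq.mem k) hw).analyticOrderAt_eq_zero,
      analyticOrderAt_bPair (hq.mem k) hw, if_neg]
    intro h
    exact hk (by simp [hT, h])
  have hev : bProd q * Φ =ᶠ[𝓝 w] F * bProd fun k : {k // k ∉ T} => q k := by
    filter_upwards [isOpen_rightHalfPlane.mem_nhds hw] with p hp
    rw [Pi.mul_apply, Pi.mul_apply, hB.eq_prod_mul T (rightHalfPlane_subset hp), hΦ p hp]
    ring
  have h := analyticOrderAt_congr hev
  rwa [analyticOrderAt_mul
    (analyticAt_of_differentiableOn_rightHalfPlane hB.differentiableOn hw) hΦan,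
    analyticOrderAt_mul (hF.analyticAt hw) hRan, hΦ0, hR0, add_zero, add_zero] at h

/-- The canonical factorization of a symmetric inner function. -/
theorem exists_factorization : ∃ ε a : ℝ, (ε = 1 ∨ ε = -1) ∧ 0 ≤ a ∧
    ∀ p ∈ closedRightHalfPlane, F p = ε * Complex.exp (-a * p) * bProd q p := by
  have hB := hq.isBlaschkeSeq hF
  set B := bProd q with hBdef
  have hBan : ∀ p ∈ rightHalfPlane, AnalyticAt ℂ B p := fun p hp =>
    analyticAt_of_differentiableOn_rightHalfPlane hB.differentiableOn hp
  have hmer : MeromorphicOn (F / B) rightHalfPlane := fun p hp =>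
    (hF.analyticAt hp).meromorphicAt.div (hBan p hp).meromorphicAt
  -- Pointwise division returns 0 at zeros of `B`; the normal form fills in the removable
  -- singularities and leaves the values on the axis unchanged.
  set G := toMeromorphicNFOn (F / B) rightHalfPlane with hG
  have hNF : ∀ p ∈ rightHalfPlane, MeromorphicNFAt G p := fun p hp =>
    meromorphicNFOn_toMeromorphicNFOn _ _ hp
  have hord : ∀ p ∈ rightHalfPlane, meromorphicOrderAt G p = 0 := by
    intro p hp
    rw [hG, meromorphicOrderAt_toMeromorphicNFOn hmer hp,
      meromorphicOrderAt_div (hF.analyticAt hp).meromorphicAt (hBan p hp).meromorphicAt,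
      (hF.analyticAt hp).meromorphicOrderAt_eq, (hBan p hp).meromorphicOrderAt_eq,
      hF.analyticOrderAt_bProd hq hp]
    have := hF.analyticOrderAt_ne_top hp
    lift analyticOrderAt F p to ℕ using this with n
    change ((n : ℤ) : WithTop ℤ) - ((n : ℤ) : WithTop ℤ) = 0
    norm_cast
    simp
  have hGan : ∀ p ∈ rightHalfPlane, AnalyticAt ℂ G p := fun p hp =>
    (hNF p hp).meromorphicOrderAt_nonneg_iff_analyticAt.1 (hord p hp).ge
  have hG0 : ∀ p ∈ rightHalfPlane, G p ≠ 0 := fun p hp =>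
    (hNF p hp).meromorphicOrderAt_eq_zero_iff.1 (hord p hp)
  have hBne : ∀ p ∈ rightHalfPlane, ∀ᶠ u in 𝓝[≠] p, B u ≠ 0 := by
    intro p hp
    refine (hBan p hp).eventually_eq_zero_or_eventually_ne_zero.resolve_left fun h => ?_
    have h1 := analyticOrderAt_eq_top.2 h
    rw [hF.analyticOrderAt_bProd hq hp] at h1
    exact hF.analyticOrderAt_ne_top hp h1
  have hFBG : ∀ p ∈ rightHalfPlane, F p = B p * G p := by
    intro p hp
    have h1 : ∀ᶠ u in 𝓝[≠] p, F u = B u * G u := by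
      filter_upwards [hmer.toMeromorphicNFOn_eq_self_on_nhdsNE hp, hBne p hp] with u hu hu'
      rw [hG, hu, Pi.div_apply, mul_div_cancel₀ _ hu']
    have h2 : F =ᶠ[𝓝 p] B * G :=
      ((hF.analyticAt hp).frequently_eq_iff_eventually_eq ((hBan p hp).mul (hGan p hp))).1
        h1.frequently
    exact h2.eq_of_nhds
  have hBaxis : ∀ p : ℂ, p.re = 0 → B p ≠ 0 := by
    intro p hp h
    have := hB.norm_eq_one hp
    rw [← hBdef, h] at this
    simp at this
  have hGout : ∀ p : ℂ, p.re = 0 → G p = F p / B p := by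
    intro p hp
    have : p ∈ rightHalfPlaneᶜ := by simp [rightHalfPlane, hp]
    exact (toMeromorphicNFOn_eq_self_on_compl hmer this)
  have hGdiv : ∀ p ∈ closedRightHalfPlane, B p ≠ 0 → G p = F p / B p := by
    intro p hp hBp
    rcases (show 0 ≤ p.re from hp).eq_or_lt with h | h
    · exact hGout p h.symm
    · rw [hFBG p h, mul_div_cancel_left₀ _ hBp]
  have hGle : ∀ p ∈ rightHalfPlane, ‖G p‖ ≤ 1 := by
    intro p hp
    refine le_of_tendsto
      (((hGan p hp).continuousAt.tendsto.mono_left nhdsWithin_le_nhds).norm :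
        Tendsto _ (𝓝[≠] p) _) ?_
    filter_upwards [hBne p hp, mem_nhdsWithin_of_mem_nhds (isOpen_rightHalfPlane.mem_nhds hp)]
      with u hu hu'
    rw [hGdiv u (rightHalfPlane_subset hu') hu, norm_div]
    exact div_le_one_of_le₀ (hF.norm_le_norm_bProd hq hu') (norm_nonneg _)
  have hGc : ContinuousOn G closedRightHalfPlane := by
    intro p hp
    rcases (show 0 ≤ p.re from hp).eq_or_lt with h | h
    · have h1 : ContinuousWithinAt (fun u => F u / B u) closedRightHalfPlane p :=
        (hF.continuousOn p hp).div (hB.continuousOn p hp) (hBaxis p h.symm)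
      refine h1.congr_of_eventuallyEq ?_ (hGout p h.symm)
      filter_upwards [(hB.continuousOn p hp).eventually_ne (hBaxis p h.symm),
        self_mem_nhdsWithin] with u hu hu'
      exact hGdiv u hu' hu
    · exact (hGan p h).continuousAt.continuousWithinAt
  have hz : (0 : ℂ) ∈ closedRightHalfPlane := by simp [closedRightHalfPlane]
  obtain ⟨ε, a, hε, ha, h⟩ := exists_eq_exp_of_nonvanishing hGc
    (fun p hp => (hGan p hp).differentiableAt.differentiableWithinAt) hG0 hGle
    (fun p hp => by
      rw [hGout p hp, norm_div, hF.norm_eq_one p hp, hB.norm_eq_one hp, div_one])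
    (by
      have h1 := hF.apply_conj 0 hz
      have h2 := hB.apply_conj hz
      rw [map_zero] at h1 h2
      rw [hGout 0 rfl, map_div₀, ← h1, ← h2])
  refine ⟨ε, a, hε, ha, fun p hp => ?_⟩
  rw [← h p hp]
  rcases (show 0 ≤ p.re from hp).eq_or_lt with h' | h'
  · rw [hGout p h'.symm, div_mul_cancel₀ _ (hBaxis p h'.symm)]
  · rw [hFBG p h', mul_comm]

end IsSymmetricInner

/-! ### The map `-i sinh` from the strip to the half-plane. -/

lemma sinh_re_eq (ζ : ℂ) : (Complex.sinh ζ).re = Real.sinh ζ.re * Real.cos ζ.im := by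
  conv_lhs => rw [← Complex.re_add_im ζ, Complex.sinh_add, Complex.sinh_mul_I, Complex.cosh_mul_I]
  simp [Complex.sinh_ofReal_re, Complex.cosh_ofReal_re, Complex.sin_ofReal_re, Complex.cos_ofReal_re]

lemma sinh_im_eq (ζ : ℂ) : (Complex.sinh ζ).im = Real.cosh ζ.re * Real.sin ζ.im := by
  conv_lhs => rw [← Complex.re_add_im ζ, Complex.sinh_add, Complex.sinh_mul_I, Complex.cosh_mul_I]
  simp [Complex.sinh_ofReal_re, Complex.cosh_ofReal_re, Complex.sin_ofReal_re, Complex.cos_ofReal_re]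

/-- The map `ζ ↦ -i sinh ζ` from the strip onto the right half-plane. -/
noncomputable def stripMap (ζ : ℂ) : ℂ := -I * Complex.sinh ζ

lemma stripMap_re (ζ : ℂ) : (stripMap ζ).re = Real.cosh ζ.re * Real.sin ζ.im := by
  simp [stripMap, sinh_im_eq]

lemma stripMap_im (ζ : ℂ) : (stripMap ζ).im = -(Real.sinh ζ.re * Real.cos ζ.im) := by
  simp [stripMap, sinh_re_eq]

lemma differentiable_stripMap : Differentiable ℂ stripMap := by
  unfold stripMap; fun_prop

lemma openStrip_subset : openStrip ⊆ closedStrip := fun _ h => ⟨h.1.le, h.2.le⟩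

lemma isOpen_openStrip : IsOpen openStrip :=
  (isOpen_lt continuous_const Complex.continuous_im).inter
    (isOpen_lt Complex.continuous_im continuous_const)

lemma isClosed_closedStrip : IsClosed closedStrip :=
  (isClosed_le continuous_const Complex.continuous_im).inter
    (isClosed_le Complex.continuous_im continuous_const)

lemma stripMap_mem_closed {ζ : ℂ} (h : ζ ∈ closedStrip) : stripMap ζ ∈ closedRightHalfPlane := by
  change 0 ≤ (stripMap ζ).re
  rw [stripMap_re]
  exact mul_nonneg (Real.cosh_pos _).le (Real.sin_nonneg_of_nonneg_of_le_pi h.1 h.2)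

lemma stripMap_mem_open {ζ : ℂ} (h : ζ ∈ openStrip) : stripMap ζ ∈ rightHalfPlane := by
  change 0 < (stripMap ζ).re
  rw [stripMap_re]
  exact mul_pos (Real.cosh_pos _) (Real.sin_pos_of_pos_of_lt_pi h.1 h.2)

lemma mem_openStrip_of_stripMap {ζ : ℂ} (h : ζ ∈ closedStrip) (h' : stripMap ζ ∈ rightHalfPlane) :
    ζ ∈ openStrip := by
  have hre : 0 < (stripMap ζ).re := h'
  rw [stripMap_re] at hre
  refine ⟨h.1.lt_of_ne' fun h0 => ?_, h.2.lt_of_ne fun h0 => ?_⟩ <;> simp [h0] at hre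

lemma im_eq_of_stripMap_re_eq_zero {ζ : ℂ} (h : ζ ∈ closedStrip) (h' : (stripMap ζ).re = 0) :
    ζ.im = 0 ∨ ζ.im = Real.pi := by
  by_contra! hne
  have : ζ ∈ openStrip := ⟨h.1.lt_of_ne' hne.1, h.2.lt_of_ne hne.2⟩
  exact (stripMap_mem_open this).ne' h'

/-- A preimage under sine is shifted by a multiple of `2π` so that its real part lies in `(-π, π]`;
`Re p ≥ 0` then makes the sine of that part nonnegative, which leaves `[0, π]`. -/
lemma exists_stripMap_eq {p : ℂ} (hp : p ∈ closedRightHalfPlane) :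
    ∃ ζ ∈ closedStrip, stripMap ζ = p := by
  obtain ⟨η, hη⟩ := Complex.sin_surjective p
  have hpi := Real.pi_pos
  set n := toIocDiv Real.two_pi_pos (-Real.pi) η.re
  have hmem := sub_toIocDiv_zsmul_mem_Ioc Real.two_pi_pos (-Real.pi) η.re
  set η' : ℂ := η - n * (2 * Real.pi) with hη'
  have hre : η'.re = η.re - n • (2 * Real.pi) := by simp [hη']
  have him : (η' * I).im = η'.re := by simp
  have hs : stripMap (η' * I) = p := by
    rw [stripMap, Complex.sinh_mul_I, hη', Complex.sin_sub_int_mul_two_pi, hη]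
    linear_combination -p * I_mul_I
  refine ⟨η' * I, ?_, hs⟩
  rw [← hre] at hmem
  have hpre : 0 ≤ p.re := hp
  rw [← hs, stripMap_re, him] at hpre
  have hsin : 0 ≤ Real.sin η'.re := nonneg_of_mul_nonneg_right hpre (Real.cosh_pos _)
  refine ⟨?_, ?_⟩
  · rw [him]
    by_contra! hlt
    exact absurd (Real.sin_neg_of_neg_of_neg_pi_lt hlt hmem.1) (not_lt.2 hsin)
  · rw [him]
    linarith [hmem.2]

lemma eq_or_eq_of_stripMap_eq {ζ ξ : ℂ} (hζ : ζ ∈ closedStrip) (hξ : ξ ∈ closedStrip)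
    (h : stripMap ζ = stripMap ξ) : ξ = ζ ∨ ξ = I * Real.pi - ζ := by
  have hpi := Real.pi_pos
  have hs : Complex.sin (ζ * I) = Complex.sin (ξ * I) := by
    rw [Complex.sin_mul_I, Complex.sin_mul_I]
    unfold stripMap at h
    linear_combination -h
  obtain ⟨k, hk | hk⟩ := Complex.sin_eq_sin_iff.1 hs
  · left
    have him : ξ.im = ζ.im - 2 * k * Real.pi := by
      have := congrArg Complex.re hk
      simp at this
      linarith
    have h1 : (k : ℝ) < 1 := by nlinarith [hζ.1, hζ.2, hξ.1, hξ.2]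
    have h2 : (-1 : ℝ) < k := by nlinarith [hζ.1, hζ.2, hξ.1, hξ.2]
    have hk0 : k = 0 := by
      have h3 : k < 1 := by exact_mod_cast h1
      have h4 : -1 < k := by exact_mod_cast h2
      omega
    subst hk0
    apply mul_right_cancel₀ I_ne_zero
    simpa using hk
  · right
    have him : ξ.im = -(2 * k + 1) * Real.pi - ζ.im := by
      have := congrArg Complex.re hk
      simp at this
      linarith
    have h1 : (k : ℝ) < 0 := by nlinarith [hζ.1, hζ.2, hξ.1, hξ.2]
    have h2 : (-2 : ℝ) < k := by nlinarith [hζ.1, hζ.2, hξ.1, hξ.2]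
    have hk0 : k = -1 := by
      have h3 : k < 0 := by exact_mod_cast h1
      have h4 : -2 < k := by exact_mod_cast h2
      omega
    subst hk0
    apply mul_right_cancel₀ I_ne_zero
    rw [hk]
    push_cast
    linear_combination -Real.pi * I_mul_I

lemma stripMap_neg_conj (ζ : ℂ) : stripMap (-conj ζ) = conj (stripMap ζ) := by
  simp [stripMap, Complex.sinh_neg, Complex.sinh_conj]

/-- Makes `stripMap` proper on the closed strip. -/
lemma abs_re_le_norm_stripMap (ζ : ℂ) : |ζ.re| ≤ ‖stripMap ζ‖ := by
  have h1 : ‖stripMap ζ‖ ^ 2 = Real.sinh ζ.re ^ 2 + Real.sin ζ.im ^ 2 := by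
    rw [← Complex.normSq_eq_norm_sq, Complex.normSq_apply, stripMap_re, stripMap_im]
    have h2 := Real.cosh_sq ζ.re
    have h3 := Real.sin_sq_add_cos_sq ζ.im
    linear_combination Real.sin ζ.im ^ 2 * h2 + Real.sinh ζ.re ^ 2 * h3
  have h2 : |ζ.re| ≤ |Real.sinh ζ.re| := by
    rw [Real.abs_sinh]
    exact Real.self_le_sinh_iff.2 (abs_nonneg _)
  refine h2.trans (abs_le_of_sq_le_sq ?_ (norm_nonneg _))
  nlinarith [sq_nonneg (Real.sin ζ.im)]

lemma isCompact_closedStrip_inter (R : ℝ) :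
    IsCompact (closedStrip ∩ stripMap ⁻¹' Metric.closedBall 0 R) := by
  refine Metric.isCompact_of_isClosed_isBounded (isClosed_closedStrip.inter
    (Metric.isClosed_closedBall.preimage differentiable_stripMap.continuous)) ?_
  refine (Metric.isBounded_closedBall (x := (0 : ℂ)) (r := R + Real.pi)).subset ?_
  rintro ζ ⟨h1, h2⟩
  rw [mem_preimage, mem_closedBall_zero_iff] at h2
  rw [mem_closedBall_zero_iff]
  refine (Complex.norm_le_abs_re_add_abs_im ζ).trans ?_
  rw [abs_of_nonneg h1.1]
  linarith [abs_re_le_norm_stripMap ζ, h1.2]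

/-- A continuous map from a compact set to a Hausdorff space is closed, hence a quotient map onto
its image. Continuity thus descends through `stripMap` even at its critical point and at the
boundary, without a continuous inverse. -/
lemma continuousOn_image_of_comp {X Y Z : Type*} [TopologicalSpace X] [TopologicalSpace Y]
    [TopologicalSpace Z] [T2Space X] [T2Space Y] {K : Set X} (hK : IsCompact K) {s : X → Y}
    {F : Y → Z} (hs : ContinuousOn s K) (hF : ContinuousOn (F ∘ s) K) :
    ContinuousOn F (s '' K) := by
  refine continuousOn_iff_isClosed.2 fun t ht => ⟨s '' (K ∩ (F ∘ s) ⁻¹' t), ?_, ?_⟩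
  · have hc := hF.preimage_isClosed_of_isClosed hK.isClosed ht
    exact ((hK.of_isClosed_subset hc inter_subset_left).image_of_continuousOn
      (hs.mono inter_subset_left)).isClosed
  · ext y
    constructor
    · rintro ⟨hy, x, hx, rfl⟩
      exact ⟨⟨x, ⟨hx, hy⟩, rfl⟩, x, hx, rfl⟩
    · rintro ⟨⟨x, ⟨hx, hy⟩, rfl⟩, hy'⟩
      exact ⟨hy, hy'⟩

lemma closedStrip_reflect {ζ : ℂ} (h : ζ ∈ closedStrip) : I * Real.pi - ζ ∈ closedStrip := by
  have h1 := h.1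
  have h2 := h.2
  constructor <;> simp <;> linarith

lemma closedStrip_neg_conj {ζ : ℂ} (h : ζ ∈ closedStrip) : -conj ζ ∈ closedStrip := by
  simpa [closedStrip] using h

lemma openStrip_reflect {ζ : ℂ} (h : ζ ∈ openStrip) : I * Real.pi - ζ ∈ openStrip := by
  have h1 := h.1
  have h2 := h.2
  constructor <;> simp <;> linarith

lemma openStrip_neg_conj {ζ : ℂ} (h : ζ ∈ openStrip) : -conj ζ ∈ openStrip := by
  simpa [openStrip] using h

/-! ### Phragmén–Lindelöf on the strip; scattering functions as inner functions. -/

lemma closure_openStrip : closure openStrip = closedStrip := by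
  have h : openStrip = Complex.im ⁻¹' Ioo 0 Real.pi := rfl
  rw [h, Complex.closure_preimage_im, closure_Ioo Real.pi_pos.ne]
  rfl

lemma diffContOnCl_openStrip {f : ℂ → ℂ} (hd : ∀ ζ ∈ openStrip, DifferentiableAt ℂ f ζ)
    (hc : ContinuousOn f closedStrip) : DiffContOnCl ℂ f (Complex.im ⁻¹' Ioo 0 Real.pi) :=
  ⟨fun ζ hζ => (hd ζ hζ).differentiableWithinAt, by
    have := closure_openStrip
    rw [show Complex.im ⁻¹' Ioo 0 Real.pi = openStrip from rfl, this]
    exact hc⟩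

lemma strip_growth {f : ℂ → ℂ} (hb : ∃ C : ℝ, ∀ ζ ∈ closedStrip, ‖f ζ‖ ≤ C) :
    ∃ c < Real.pi / (Real.pi - 0), ∃ B,
      f =O[comap (_root_.abs ∘ re) atTop ⊓ 𝓟 (im ⁻¹' Ioo 0 Real.pi)]
        fun z ↦ Real.exp (B * Real.exp (c * |z.re|)) := by
  obtain ⟨C, hC⟩ := hb
  refine ⟨0, by rw [sub_zero, div_self Real.pi_pos.ne']; exact one_pos, 0, ?_⟩
  refine Asymptotics.IsBigO.of_bound C ?_
  refine Eventually.filter_mono inf_le_right ?_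
  rw [eventually_principal]
  intro ζ hζ
  simpa using hC ζ (openStrip_subset hζ)

lemma eq_on_strip_of_eq_on_boundary {f g : ℂ → ℂ}
    (hfd : ∀ ζ ∈ openStrip, DifferentiableAt ℂ f ζ) (hfc : ContinuousOn f closedStrip)
    (hfb : ∃ C : ℝ, ∀ ζ ∈ closedStrip, ‖f ζ‖ ≤ C)
    (hgd : ∀ ζ ∈ openStrip, DifferentiableAt ℂ g ζ) (hgc : ContinuousOn g closedStrip)
    (hgb : ∃ C : ℝ, ∀ ζ ∈ closedStrip, ‖g ζ‖ ≤ C)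
    (h0 : ∀ θ : ℝ, f θ = g θ) (h1 : ∀ θ : ℝ, f (θ + I * Real.pi) = g (θ + I * Real.pi)) :
    ∀ ζ ∈ closedStrip, f ζ = g ζ := by
  intro ζ hζ
  refine PhragmenLindelof.eqOn_horizontal_strip (diffContOnCl_openStrip hfd hfc) (strip_growth hfb)
    (diffContOnCl_openStrip hgd hgc) (strip_growth hgb) (fun z hz => ?_) (fun z hz => ?_) hζ
  · rw [show z = (z.re : ℂ) by apply Complex.ext <;> simp [hz]]
    exact h0 _
  · rw [show z = (z.re : ℂ) + I * Real.pi by apply Complex.ext <;> simp [hz]]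
    exact h1 _

namespace IsScatteringFunction

variable {S : ℂ → ℂ} (hS : IsScatteringFunction S)
include hS

lemma differentiableAt {ζ : ℂ} (h : ζ ∈ openStrip) : DifferentiableAt ℂ S ζ :=
  (hS.analytic ζ h).differentiableAt

lemma apply_neg (θ : ℝ) : S (-θ) = conj (S θ) := by
  rw [hS.conj_eq_inv, hS.inv_eq_neg]

lemma apply_shift (θ : ℝ) : S (θ + I * Real.pi) = conj (S θ) := by
  rw [← hS.neg_eq_shift, hS.apply_neg]

lemma norm_real (θ : ℝ) : ‖S θ‖ = 1 := by
  have h : S θ * conj (S θ) = 1 := by rw [hS.conj_eq_inv, mul_inv_cancel₀ (hS.ne_zero θ)]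
  rw [Complex.mul_conj, Complex.normSq_eq_norm_sq] at h
  have h3 : ‖S θ‖ ^ 2 = 1 := by exact_mod_cast h
  nlinarith [norm_nonneg (S θ)]

lemma norm_boundary {ζ : ℂ} (h : ζ.im = 0 ∨ ζ.im = Real.pi) : ‖S ζ‖ = 1 := by
  rcases h with h | h
  · rw [show ζ = (ζ.re : ℂ) by apply Complex.ext <;> simp [h]]
    exact hS.norm_real _
  · rw [show ζ = (ζ.re : ℂ) + I * Real.pi by apply Complex.ext <;> simp [h], hS.apply_shift,
      RCLike.norm_conj]
    exact hS.norm_real _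

lemma norm_le_one {ζ : ℂ} (h : ζ ∈ closedStrip) : ‖S ζ‖ ≤ 1 :=
  PhragmenLindelof.horizontal_strip
    (diffContOnCl_openStrip (fun _ hζ => hS.differentiableAt hζ) hS.continuousOn)
    (strip_growth hS.bounded) (fun _ hz => (hS.norm_boundary (Or.inl hz)).le)
    (fun _ hz => (hS.norm_boundary (Or.inr hz)).le) h.1 h.2

/-- Both sides are bounded and holomorphic in the strip, and on each edge their equality is the
relation `S(-θ) = S(θ + iπ)`. -/
lemma apply_reflect {ζ : ℂ} (h : ζ ∈ closedStrip) : S (I * Real.pi - ζ) = S ζ := by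
  obtain ⟨C, hC⟩ := hS.bounded
  refine eq_on_strip_of_eq_on_boundary (f := fun ζ => S (I * Real.pi - ζ)) (fun ξ hξ => ?_) ?_
    ⟨C, fun ξ hξ => hC _ (closedStrip_reflect hξ)⟩ (fun _ hξ => hS.differentiableAt hξ)
    hS.continuousOn ⟨C, hC⟩ (fun θ => ?_) (fun θ => ?_) ζ h
  · exact DifferentiableAt.comp ξ (hS.differentiableAt (openStrip_reflect hξ)) (by fun_prop)
  · exact hS.continuousOn.comp (by fun_prop) fun ξ hξ => closedStrip_reflect hξ
  · have := hS.neg_eq_shift (-θ)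
    push_cast at this
    rw [neg_neg] at this
    simp only [this]
    congr 1
    ring
  · have := hS.neg_eq_shift θ
    simp only [← this]
    congr 1
    ring

lemma apply_neg_conj {ζ : ℂ} (h : ζ ∈ closedStrip) : S (-conj ζ) = conj (S ζ) := by
  obtain ⟨C, hC⟩ := hS.bounded
  have key : conj (S (-conj ζ)) = S ζ := by
    refine eq_on_strip_of_eq_on_boundary (f := fun ζ => conj (S (-conj ζ))) (fun ξ hξ => ?_) ?_
      ⟨C, fun ξ hξ => by simpa using hC _ (closedStrip_neg_conj hξ)⟩
      (fun _ hξ => hS.differentiableAt hξ)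
      hS.continuousOn ⟨C, hC⟩ (fun θ => ?_) (fun θ => ?_) ζ h
    · have h2 : DifferentiableAt ℂ (fun p => S (-p)) (conj ξ) :=
        DifferentiableAt.comp (conj ξ) (g := S) (hS.differentiableAt (openStrip_neg_conj hξ))
          (by fun_prop)
      simpa [Function.comp_def] using h2.conj_conj
    · exact Complex.continuous_conj.comp_continuousOn (hS.continuousOn.comp
        Complex.continuous_conj.neg.continuousOn fun ξ hξ => closedStrip_neg_conj hξ)
    · simp [hS.apply_neg]
    · have := hS.apply_shift (-θ)
      simp only [map_add, map_mul, Complex.conj_ofReal, conj_I]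
      rw [hS.apply_shift, show -((θ : ℂ) + -I * Real.pi) = ((-θ : ℝ) : ℂ) + I * Real.pi by
        push_cast; ring, this]
      push_cast
      rw [hS.apply_neg]
      simp
  rw [← key, Complex.conj_conj]

/-- Every scattering function is a symmetric inner function of `-i sinh ζ`. -/
theorem exists_isSymmetricInner :
    ∃ F : ℂ → ℂ, IsSymmetricInner F ∧ ∀ ζ ∈ closedStrip, S ζ = F (stripMap ζ) := by
  -- The preimage is chosen arbitrarily; `apply_reflect` makes the value independent of the choice.
  set F : ℂ → ℂ := fun p => S (Function.invFunOn stripMap closedStrip p) with hFdef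
  have hFS : ∀ ζ ∈ closedStrip, F (stripMap ζ) = S ζ := by
    intro ζ hζ
    have hex : ∃ ξ ∈ closedStrip, stripMap ξ = stripMap ζ := ⟨ζ, hζ, rfl⟩
    have h1 := Function.invFunOn_mem hex
    have h2 := Function.invFunOn_eq hex
    rcases eq_or_eq_of_stripMap_eq hζ h1 h2.symm with h | h
    · rw [hFdef]; simp only [h]
    · rw [hFdef]; simp only [h]
      exact hS.apply_reflect hζ
  have hcont : ContinuousOn F closedRightHalfPlane := by
    intro p hp
    set R := ‖p‖ + 1 with hR
    have hcp := isCompact_closedStrip_inter R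
    have h1 : ContinuousOn F (stripMap '' (closedStrip ∩ stripMap ⁻¹' Metric.closedBall 0 R)) := by
      refine continuousOn_image_of_comp hcp differentiable_stripMap.continuous.continuousOn ?_
      exact (hS.continuousOn.mono inter_subset_left).congr fun ζ hζ => hFS ζ hζ.1
    have hmem : ∀ u ∈ closedRightHalfPlane, ‖u‖ ≤ R →
        u ∈ stripMap '' (closedStrip ∩ stripMap ⁻¹' Metric.closedBall 0 R) := by
      intro u hu huR
      obtain ⟨ζ, hζ, rfl⟩ := exists_stripMap_eq hu
      exact ⟨ζ, ⟨hζ, by simpa using huR⟩, rfl⟩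
    refine (h1 p (hmem p hp (by linarith))).mono_of_mem_nhdsWithin ?_
    filter_upwards [self_mem_nhdsWithin,
      mem_nhdsWithin_of_mem_nhds (Metric.ball_mem_nhds p one_pos)] with u hu hu'
    refine hmem u hu ?_
    have := norm_add_le p (u - p)
    rw [add_sub_cancel] at this
    have h3 : ‖u - p‖ < 1 := by simpa [dist_eq_norm] using hu'
    linarith
  -- The point 1 is the only critical value in the half-plane: `cosh ζ = 0` forces `p² = 1`.
  -- Elsewhere a local inverse of `stripMap` works; at 1 the singularity is removable by continuity.
  have hdiff1 : ∀ p ∈ rightHalfPlane, p ≠ 1 → DifferentiableAt ℂ F p := by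
    intro p hp hp1
    obtain ⟨ζ, hζ, rfl⟩ := exists_stripMap_eq (rightHalfPlane_subset hp)
    have hζo := mem_openStrip_of_stripMap hζ hp
    have hcosh : Complex.cosh ζ ≠ 0 := by
      intro h
      have h1 := Complex.cosh_sq ζ
      rw [h] at h1
      have h2 : (stripMap ζ - 1) * (stripMap ζ + 1) = 0 := by
        unfold stripMap
        linear_combination h1 + Complex.sinh ζ ^ 2 * I_mul_I
      rcases mul_eq_zero.1 h2 with h3 | h3
      · exact hp1 (sub_eq_zero.1 h3)
      · have h4 : 0 < (stripMap ζ).re := hp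
        rw [eq_neg_of_add_eq_zero_left h3] at h4
        simp at h4
        linarith
    have hsd : HasStrictDerivAt stripMap (-I * Complex.cosh ζ) ζ :=
      (Complex.hasStrictDerivAt_sinh ζ).const_mul (-I)
    have hne : -I * Complex.cosh ζ ≠ 0 := mul_ne_zero (neg_ne_zero.2 I_ne_zero) hcosh
    have hli := hsd.to_localInverse hne
    set g := hsd.localInverse stripMap (-I * Complex.cosh ζ) ζ hne with hg
    have hgp : g (stripMap ζ) = ζ := HasStrictFDerivAt.localInverse_apply_image _
    have hgd : DifferentiableAt ℂ g (stripMap ζ) := hli.hasDerivAt.differentiableAt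
    have hri : ∀ᶠ y in 𝓝 (stripMap ζ), stripMap (g y) = y :=
      HasStrictFDerivAt.eventually_right_inverse _
    have hgs : ∀ᶠ y in 𝓝 (stripMap ζ), g y ∈ openStrip :=
      hgd.continuousAt.eventually_mem (isOpen_openStrip.mem_nhds (by rwa [hgp]))
    have hcomp : DifferentiableAt ℂ (S ∘ g) (stripMap ζ) :=
      DifferentiableAt.comp _ (by rw [hgp]; exact hS.differentiableAt hζo) hgd
    refine hcomp.congr_of_eventuallyEq ?_
    filter_upwards [hri, hgs] with y hy hy'
    rw [Function.comp_apply, ← hFS _ (openStrip_subset hy'), hy]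
  have h1mem : (1 : ℂ) ∈ rightHalfPlane := by simp [rightHalfPlane]
  refine ⟨F, ⟨hcont, ?_, ?_, ?_, ?_⟩, fun ζ hζ => (hFS ζ hζ).symm⟩
  · have hn : rightHalfPlane ∈ 𝓝 (1 : ℂ) := isOpen_rightHalfPlane.mem_nhds h1mem
    refine (differentiableOn_compl_singleton_and_continuousAt_iff hn).1 ⟨fun p hp => ?_, ?_⟩
    · exact (hdiff1 p hp.1 hp.2).differentiableWithinAt
    · exact (hcont 1 (rightHalfPlane_subset h1mem)).continuousAt
        (mem_of_superset hn rightHalfPlane_subset)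
  · intro p hp
    obtain ⟨ζ, hζ, rfl⟩ := exists_stripMap_eq (rightHalfPlane_subset hp)
    rw [hFS ζ hζ]
    exact hS.norm_le_one hζ
  · intro p hp
    obtain ⟨ζ, hζ, rfl⟩ := exists_stripMap_eq (p := p) hp.ge
    rw [hFS ζ hζ]
    exact hS.norm_boundary (im_eq_of_stripMap_re_eq_zero hζ hp)
  · intro p hp
    obtain ⟨ζ, hζ, rfl⟩ := exists_stripMap_eq hp
    rw [← stripMap_neg_conj, hFS ζ hζ, hFS _ (closedStrip_neg_conj hζ)]
    exact hS.apply_neg_conj hζ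

end IsScatteringFunction

/-! ### Zero sequences translated to Blaschke sequences. -/

lemma sinhFactor_eq (β ζ : ℂ) : sinhFactor β ζ = bFactor (stripMap β) (stripMap ζ) := by
  unfold sinhFactor bFactor stripMap
  rw [← mul_sub, ← mul_add, mul_div_mul_left _ _ (neg_ne_zero.2 I_ne_zero)]

/-- As `Im (stripMap β) = -sinh(Re β) cos(Im β)`, positive real part corresponds to the lower
half-plane, which fixes the convention in `bPair`; the unpaired cases correspond to the real axis.
-/
lemma pairedFactor_eq {β : ℂ} (h0 : 0 < β.im) (h1 : β.im ≤ Real.pi / 2) (ζ : ℂ) :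
    pairedFactor β ζ = bPair (stripMap β) (stripMap ζ) := by
  have hpi := Real.pi_pos
  have hcos : β.im ≠ Real.pi / 2 → 0 < Real.cos β.im := fun h =>
    Real.cos_pos_of_mem_Ioo ⟨by linarith, lt_of_le_of_ne h1 h⟩
  have hiff : (stripMap β).im = 0 ↔ β.re = 0 ∨ β.im = Real.pi / 2 := by
    rw [stripMap_im, neg_eq_zero, mul_eq_zero, Real.sinh_eq_zero]
    refine or_congr_right ⟨fun h => ?_, fun h => by rw [h, Real.cos_pi_div_two]⟩
    by_contra hne
    exact (hcos hne).ne' h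
  unfold pairedFactor bPair
  by_cases h : β.re = 0 ∨ β.im = Real.pi / 2
  · rw [if_pos h, if_pos (hiff.2 h), sinhFactor_eq]
  · have hlt : (stripMap β).im < 0 ↔ 0 < β.re := by
      rw [stripMap_im, neg_neg_iff_pos,
        mul_pos_iff_of_pos_right (hcos fun h' => h (Or.inr h')), Real.sinh_pos_iff]
    rw [if_neg h, if_neg (hiff.not.2 h)]
    simp only [hlt, sinhFactor_eq, stripMap_neg_conj]

lemma im_one_div_sinh (β : ℂ) :
    (1 / Complex.sinh β).im = -((stripMap β).re / ‖stripMap β‖ ^ 2) := by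
  have h : ‖stripMap β‖ = ‖Complex.sinh β‖ := by simp [stripMap]
  rw [h, one_div, Complex.inv_im, Complex.normSq_eq_norm_sq, neg_div]
  simp [stripMap]

namespace IsZeroSequence

variable {N : ℕ∞} {β : SeqIndex N → ℂ} (hβ : IsZeroSequence β)
include hβ

lemma mem_openStrip (k : SeqIndex N) : β k ∈ openStrip :=
  ⟨hβ.im_pos k, by linarith [hβ.im_le k, Real.pi_pos]⟩

/-- Infinitely many terms in a disc would place infinitely many `β k` in a compact part of the
strip, producing a forbidden limit point. -/
lemma isBlaschkeSeq : IsBlaschkeSeq fun k => stripMap (β k) where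
  re_pos k := stripMap_mem_open (hβ.mem_openStrip k)
  finite R := by
    by_contra hinf
    have hfr : ∃ᶠ k in cofinite, β k ∈ closedStrip ∩ stripMap ⁻¹' Metric.closedBall 0 R := by
      refine (frequently_cofinite_iff_infinite.2 hinf).mono fun k hk => ?_
      exact ⟨openStrip_subset (hβ.mem_openStrip k), by simpa using hk⟩
    obtain ⟨z, -, hz⟩ := (isCompact_closedStrip_inter R).exists_mapClusterPt_of_frequently hfr
    exact hβ.no_limit_point z hz
  summable := by
    have h := hβ.summable.neg
    simpa only [im_one_div_sinh, neg_neg] using h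

lemma pairedFactor_eq_bPair (k : SeqIndex N) (ζ : ℂ) :
    pairedFactor (β k) ζ = bPair (stripMap (β k)) (stripMap ζ) :=
  pairedFactor_eq (hβ.im_pos k) (hβ.im_le k) ζ

lemma tprod_eq (ζ : ℂ) :
    ∏' k, pairedFactor (β k) ζ = bProd (fun k => stripMap (β k)) (stripMap ζ) := by
  simp only [hβ.pairedFactor_eq_bPair, bProd]

/-- Absolute and uniform convergence of the product on compact subsets of the closed strip. -/
theorem uniform_convergence {K : Set ℂ} (hKs : K ⊆ closedStrip) (hK : IsCompact K) :
    SummableUniformlyOn (fun k ζ => ‖pairedFactor (β k) ζ - 1‖) K ∧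
      HasProdUniformlyOn (fun k ζ => pairedFactor (β k) ζ)
        (fun ζ => ∏' k, pairedFactor (β k) ζ) K := by
  have hK' : IsCompact (stripMap '' K) := hK.image differentiable_stripMap.continuous
  have hKs' : stripMap '' K ⊆ closedRightHalfPlane := by
    rintro _ ⟨ζ, hζ, rfl⟩
    exact stripMap_mem_closed (hKs hζ)
  constructor
  · obtain ⟨g, hg⟩ := (hβ.isBlaschkeSeq.summableUniformlyOn hK' hKs').exists
    have h1 := (hasSumUniformlyOn_iff_tendstoUniformlyOn.1 hg).comp stripMap
    refine HasSumUniformlyOn.summableUniformlyOn (g := g ∘ stripMap) ?_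
    rw [hasSumUniformlyOn_iff_tendstoUniformlyOn]
    simp only [hβ.pairedFactor_eq_bPair]
    exact h1.mono (subset_preimage_image _ _)
  · have h1 := (hasProdUniformlyOn_iff_tendstoUniformlyOn.1
      (hβ.isBlaschkeSeq.hasProdUniformlyOn hK' hKs')).comp stripMap
    rw [hasProdUniformlyOn_iff_tendstoUniformlyOn]
    simp only [hβ.pairedFactor_eq_bPair]
    exact h1.mono (subset_preimage_image _ _)

end IsZeroSequence

/-! ### Passing back to the strip, and the main theorem. -/

lemma stripMap_real (θ : ℝ) : (stripMap θ).re = 0 := by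
  simp [stripMap_re]

lemma stripMap_neg_real (θ : ℝ) : stripMap (-θ) = conj (stripMap θ) := by
  rw [← stripMap_neg_conj, Complex.conj_ofReal]

lemma stripMap_shift_real (θ : ℝ) : stripMap (θ + I * Real.pi) = conj (stripMap θ) := by
  rw [← stripMap_neg_real]
  simp only [stripMap, mul_comm I (Real.pi : ℂ), Complex.sinh_add, Complex.sinh_mul_I,
    Complex.cosh_mul_I, Complex.sin_pi, Complex.cos_pi, Complex.sinh_neg]
  ring

lemma exp_sinh_eq (a : ℝ) (ζ : ℂ) :
    Complex.exp (I * a * Complex.sinh ζ) = Complex.exp (-a * stripMap ζ) := by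
  unfold stripMap
  congr 1
  ring

/-- Pullbacks of exponentials times Blaschke products are scattering functions. -/
theorem isScatteringFunction_of_eq {S : ℂ → ℂ} {ι : Type*} {q : ι → ℂ} (hq : IsBlaschkeSeq q)
    {ε a : ℝ} (hε : ε = 1 ∨ ε = -1) (ha : 0 ≤ a)
    (hS : ∀ ζ ∈ closedStrip,
      S ζ = ε * Complex.exp (-a * stripMap ζ) * bProd q (stripMap ζ)) :
    IsScatteringFunction S := by
  have hnε : ‖(ε : ℂ)‖ = 1 := by rcases hε with rfl | rfl <;> simp
  have hreal : ∀ θ : ℝ, (θ : ℂ) ∈ closedStrip := fun θ => by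
    simp [closedStrip, Real.pi_pos.le]
  have hshift : ∀ θ : ℝ, (θ : ℂ) + I * Real.pi ∈ closedStrip := fun θ => by
    simp [closedStrip, Real.pi_pos.le]
  have hnorm : ∀ θ : ℝ, ‖S θ‖ = 1 := by
    intro θ
    rw [hS _ (hreal θ), norm_mul, norm_mul, hnε, hq.norm_eq_one (stripMap_real θ),
      Complex.norm_exp]
    simp [stripMap_real]
  have hne : ∀ θ : ℝ, S θ ≠ 0 := fun θ h => by simpa [h] using hnorm θ
  have hconj : ∀ θ : ℝ, conj (S θ) =
      ε * Complex.exp (-a * conj (stripMap θ)) * bProd q (conj (stripMap θ)) := by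
    intro θ
    rw [hS _ (hreal θ), hq.apply_conj (stripMap_mem_closed (hreal θ)), map_mul, map_mul,
      Complex.conj_ofReal, ← Complex.exp_conj, map_mul, map_neg, Complex.conj_ofReal]
  have hneg : ∀ θ : ℝ, S (-θ) = conj (S θ) := by
    intro θ
    have := hS _ (hreal (-θ))
    rw [ofReal_neg, stripMap_neg_real] at this
    rw [hconj, this]
  have hinv : ∀ θ : ℝ, conj (S θ) = (S θ)⁻¹ := by
    intro θ
    apply eq_inv_of_mul_eq_one_right
    rw [Complex.mul_conj, Complex.normSq_eq_norm_sq, hnorm θ]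
    simp
  refine ⟨?_, ?_, ⟨1, fun ζ hζ => ?_⟩, hne, hinv, fun θ => ?_, fun θ => ?_⟩
  · refine DifferentiableOn.analyticOnNhd (DifferentiableOn.congr ?_
      fun ζ hζ => hS ζ (openStrip_subset hζ)) isOpen_openStrip
    refine DifferentiableOn.mul ?_ (hq.differentiableOn.comp
      differentiable_stripMap.differentiableOn fun ζ hζ => stripMap_mem_open hζ)
    have := differentiable_stripMap
    exact Differentiable.differentiableOn (by fun_prop)
  · refine ContinuousOn.congr ?_ hS
    refine ContinuousOn.mul ?_ (hq.continuousOn.comp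
      differentiable_stripMap.continuous.continuousOn fun ζ hζ => stripMap_mem_closed hζ)
    have := differentiable_stripMap.continuous
    exact Continuous.continuousOn (by fun_prop)
  · rw [hS ζ hζ, norm_mul, norm_mul, hnε, one_mul]
    refine mul_le_one₀ ?_ (norm_nonneg _) (hq.norm_le_one (stripMap_mem_closed hζ))
    rw [Complex.norm_exp, Real.exp_le_one_iff]
    have h1 : 0 ≤ (stripMap ζ).re := stripMap_mem_closed hζ
    have h2 := mul_nonneg ha h1
    simpa using h2
  · rw [hneg, hinv]
  · rw [hneg, hconj, hS _ (hshift θ), stripMap_shift_real]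

lemma exists_stripMap_eq_lower_half {p : ℂ} (hp : p ∈ rightHalfPlane) :
    ∃ β : ℂ, 0 < β.im ∧ β.im ≤ Real.pi / 2 ∧ stripMap β = p := by
  obtain ⟨ζ, hζ, rfl⟩ := exists_stripMap_eq (rightHalfPlane_subset hp)
  have hζo := mem_openStrip_of_stripMap hζ hp
  rcases le_total ζ.im (Real.pi / 2) with h | h
  · exact ⟨ζ, hζo.1, h, rfl⟩
  · refine ⟨I * Real.pi - ζ, (openStrip_reflect hζo).1, by simp; linarith, ?_⟩
    simp only [stripMap, mul_comm I (Real.pi : ℂ), Complex.sinh_sub, Complex.sinh_mul_I,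
      Complex.cosh_mul_I, Complex.sin_pi, Complex.cos_pi]
    ring

lemma isZeroSequence_of_listsZeros {F : ℂ → ℂ} (hF : IsSymmetricInner F) {N : ℕ∞}
    {q β : SeqIndex N → ℂ} (hq : ListsZeros F q) (hβ0 : ∀ k, 0 < (β k).im)
    (hβ1 : ∀ k, (β k).im ≤ Real.pi / 2) (hβ : ∀ k, stripMap (β k) = q k) : IsZeroSequence β := by
  have hpi := Real.pi_pos
  have hB := hq.isBlaschkeSeq hF
  -- Strictly below `Im = π/2` the reflected preimage `iπ - w` lies above the line, so
  -- multiplicities transfer unchanged. On the line itself both preimages are admissible, which is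
  -- why no symmetry is asked there.
  have hset : ∀ w : ℂ, 0 < w.im → w.im < Real.pi / 2 → {k | β k = w} = {k | q k = stripMap w} := by
    intro w hw0 hw1
    ext k
    rw [mem_ofPred_eq, mem_ofPred_eq, ← hβ k]
    refine ⟨fun h => by rw [h], fun h => ?_⟩
    have hk := hβ0 k
    have hk1 := hβ1 k
    rcases eq_or_eq_of_stripMap_eq (ζ := w) (ξ := β k) ⟨hw0.le, by linarith⟩
      ⟨hk.le, by linarith⟩ h.symm with h1 | h1
    · exact h1
    · have := congrArg Complex.im h1
      simp at this
      linarith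
  refine ⟨hβ0, hβ1, fun w => ?_, fun w hw => ?_, fun z hz => ?_, ?_⟩
  · exact (hB.finite ‖stripMap w‖).subset fun k hk => by
      simp [← hβ k, show β k = w from hk]
  · rcases le_or_gt w.im 0 with h | h
    · have e : ∀ u : ℂ, u.im ≤ 0 → {k | β k = u} = ∅ := fun u hu =>
        eq_empty_of_forall_notMem fun k hk => by
          have := hβ0 k
          rw [show β k = u from hk] at this
          linarith
      rw [e w h, e (-conj w) (by simpa using h)]
    · have hw' : stripMap w ∈ rightHalfPlane := stripMap_mem_open ⟨h, by linarith⟩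
      rw [hset w h hw, hset (-conj w) (by simpa using h) (by simpa using hw), stripMap_neg_conj,
        Set.ncard_def, Set.ncard_def, hq.encard_eq _ hw',
        hq.encard_eq _ (mem_rightHalfPlane_conj hw'), hF.analyticOrderAt_conj hw']
  · have hn : ∀ᶠ u in 𝓝 z, ‖stripMap u‖ < ‖stripMap z‖ + 1 :=
      differentiable_stripMap.continuous.norm.continuousAt.eventually_lt_const (by linarith)
    have hfr := hz.frequently hn
    refine frequently_cofinite_iff_infinite.1 hfr
      ((hB.finite (‖stripMap z‖ + 1)).subset fun k hk => ?_)
    rw [mem_ofPred_eq, hβ k] at hk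
    exact hk.le
  · simpa only [im_one_div_sinh, hβ] using hB.summable.neg

end

theorem mainTheorem10 :
    (∀ S : ℂ → ℂ, IsScatteringFunction S ↔
      ∃ (ε a : ℝ) (N : ℕ∞) (β : SeqIndex N → ℂ),
        (ε = 1 ∨ ε = -1) ∧ 0 ≤ a ∧ IsZeroSequence β ∧
        ∀ ζ ∈ closedStrip,
          S ζ = ε * Complex.exp (Complex.I * a * Complex.sinh ζ) * ∏' k, pairedFactor (β k) ζ) ∧
    (∀ (N : ℕ∞) (β : SeqIndex N → ℂ), IsZeroSequence β →
      ∀ K : Set ℂ, K ⊆ closedStrip → IsCompact K →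
        SummableUniformlyOn (fun k ζ => ‖pairedFactor (β k) ζ - 1‖) K ∧
        HasProdUniformlyOn (fun k ζ => pairedFactor (β k) ζ)
          (fun ζ => ∏' k, pairedFactor (β k) ζ) K) := by
  refine ⟨fun S => ⟨fun hS => ?_, ?_⟩, fun N β hβ K hKs hK => hβ.uniform_convergence hKs hK⟩
  · obtain ⟨F, hF, hFS⟩ := hS.exists_isSymmetricInner
    obtain ⟨N, q, hq⟩ := hF.exists_listsZeros
    choose β hβ0 hβ1 hβ using fun k => exists_stripMap_eq_lower_half (hq.mem k)
    have hz := isZeroSequence_of_listsZeros hF hq hβ0 hβ1 hβ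
    obtain ⟨ε, a, hε, ha, h⟩ := hF.exists_factorization hq
    refine ⟨ε, a, N, β, hε, ha, hz, fun ζ hζ => ?_⟩
    rw [hFS ζ hζ, h _ (stripMap_mem_closed hζ), exp_sinh_eq, hz.tprod_eq]
    simp only [hβ]
  · rintro ⟨ε, a, N, β, hε, ha, hβ, h⟩
    refine isScatteringFunction_of_eq hβ.isBlaschkeSeq hε ha fun ζ hζ => ?_
    rw [h ζ hζ, exp_sinh_eq, hβ.tprod_eq]
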